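/- **Setting.** For finite-dimensional systems let $\mathrm{LOCC}(A,B)$ be the set of superoperators on $A\otimes B$ realised by a protocol with finitely many rounds of local operations and classical communication between $A$ and $B$. In each step one party applies a local instrument with Kraus operators $K_i$, $\sum_i K_i^\dagger K_i\le 1$ (local ancillas are allowed), announces the outcome $i$, and the result may be weighted by a sign $s_i=\pm1$; all later steps may depend on all earlier outcomes. (So the local operations are the maps $\mathcal E^+-\mathcal E^-$ with $\mathcal E^\pm$ completely positive and $\mathcal E^++\mathcal E^-$ trace-nonincreasing.) For a set $S$ of superoperators put $$\gamma_S(\mathcal U)=\min\Big\{\sum_{i=1}^m|a_i| : m\ge 1,\ \mathcal U=\sum_{i=1}^m a_i\mathcal F_i,\ a_i\in\mathbb R,\ \mathcal F_i\in S\Big\};$$ the sampling overhead of such a decomposition is $\big(\sum_i|a_i|\big)^2$. If $B$ is a copy of $A$, let $\Gamma[\mathcal E](X)=\mathrm{tr}_A\,\mathcal E(X\otimes|0\rangle\langle 0|_B)$ and $\underline{\mathrm{LOCC}}(A,B)=\Gamma[\mathrm{LOCC}(A,B)]$. **Theorem.** Let $n\in\mathbb N$ (with $n=0$ allowed). 1.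 (Parallel cuts.) If $\tilde A,\tilde B$ are $n$-qubit systems, then the minimum defining the $\gamma$-factor of the identity channel is attained and $$\gamma_{\underline{\mathrm{LOCC}}(\tilde A,\tilde B)}(\mathcal I_{\tilde A\to\tilde B})=2^{n+1}-1 ,$$ so that the optimal sampling overhead is $(2^{n+1}-1)^2$. 2. (Cuts at arbitrary positions.) Consider circuits on two computers that consist of local channels on either computer and of $n$ wires, in $n$ possibly different time slices, each of which passes one qubit from one computer to the other, in a prescribed sequence of directions. A joint replacement of the $n$ cut wires lets the two computers keep memories (in a trivial state at the beginning and at the end) and, in place of each wire, perform an LOCC operation on the qubit of that wire and their memories. A quasiprobability decomposition of the cuts consists of finitely many (at least one) joint replacements $\sigma_i$ and real numbers $a_i$ such that for every circuit with this sequence of cuts (whatever the local channels are) its channel equals $\sum_i a_i$ times the map obtained from the circuit by the replacement $\sigma_i$. For each sequence of directions of length $n$, the least value of $\sum_i|a_i|$ over all such decompositions exists and equals $2^{n+1}-1$, so that the optimal sampling overhead is again $(2^{n+1}-1)^2$. -/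

import Mathlib

open scoped Kronecker ComplexOrder

namespace WireCut

/-- Operators on the finite-dimensional Hilbert space with orthonormal basis `ι`. -/
abbrev Op (ι : Type) : Type := Matrix ι ι ℂ

/-- Superoperators, that is, linear maps from operators on one system to operators on another. -/
abbrev SuperOp (ι κ : Type) : Type := Op ι →ₗ[ℂ] Op κ

/-- The Hilbert space of a qubit has the orthonormal basis `|0⟩, |1⟩`. -/
abbrev Qubit : Type := Fin 2

/-- The computational basis of `n` qubits. -/
abbrev Qubits (n : ℕ) : Type := Fin n → Qubit

/-- The map `X ↦ K X K†`. -/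
def conjMap {ι κ : Type} [Fintype ι] (K : Matrix κ ι ℂ) : SuperOp ι κ where
  toFun X := K * X * K.conjTranspose
  map_add' X Y := by rw [Matrix.mul_add, Matrix.add_mul]
  map_smul' c X := by simp

/-- Renaming of the basis along `e`; used to permute tensor factors. -/
def relabel {ι κ : Type} (e : κ ≃ ι) : SuperOp ι κ where
  toFun X := X.submatrix e e
  map_add' _ _ := rfl
  map_smul' _ _ := rfl

/-- The superoperator `E ⊗ id` on `ι ⊗ R`: `E` acts on the blocks with fixed indices in `R`. -/
def tensorId (R : Type) {ι κ : Type} (E : SuperOp ι κ) : SuperOp (ι × R) (κ × R) where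
  toFun X := Matrix.of fun p q =>
    E (Matrix.of fun i j => X (i, p.2) (j, q.2)) p.1 q.1
  map_add' X Y := by
    ext p q
    exact congrFun (congrFun (E.map_add (Matrix.of fun i j => X (i, p.2) (j, q.2))
      (Matrix.of fun i j => Y (i, p.2) (j, q.2))) p.1) q.1
  map_smul' c X := by
    ext p q
    exact congrFun (congrFun (E.map_smul c (Matrix.of fun i j => X (i, p.2) (j, q.2))) p.1) q.1

/-- The superoperator `id ⊗ G` on `M ⊗ ι`. -/
def idTensor (M : Type) {ι κ : Type} (G : SuperOp ι κ) : SuperOp (M × ι) (M × κ) :=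
  relabel (Equiv.prodComm M κ) ∘ₗ tensorId M G ∘ₗ relabel (Equiv.prodComm ι M)

/-- The partial trace over the first tensor factor. -/
def partialTraceFst {A B : Type} [Fintype A] : SuperOp (A × B) B where
  toFun X := Matrix.of fun b b' => ∑ a, X (a, b) (a, b')
  map_add' X Y := by
    ext b b'
    simp [Finset.sum_add_distrib]
  map_smul' c X := by
    ext b b'
    simp [Finset.mul_sum]

/-- The map `X ↦ X ⊗ |z⟩⟨z|` that adjoins a system in the basis state `z`. -/
def adjoinBasisState (A : Type) {B : Type} [DecidableEq B] (z : B) : SuperOp A (A × B) where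
  toFun X := X ⊗ₖ Matrix.single z z (1 : ℂ)
  map_add' X Y := Matrix.add_kronecker X Y _
  map_smul' c X := Matrix.smul_kronecker c X _

/-! ### Local operations and classical communication -/

/-- `IsLOCC E`: the map `E`, from operators on `A ⊗ B` to operators on `A' ⊗ B'`, is realised by
a protocol of local operations and classical communication with finitely many rounds.

A protocol either ends, or one party performs a local instrument: a measurement given by Kraus
operators `K i` on the system of that party, with `∑ i, (K i)† (K i) ≤ 1`. The outcome `i` is
announced, and the parties continue with a protocol `P i` that may depend on it (hence on all the
outcomes so far). The systems may change their dimension, so local ancillas may be added and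
discarded. As `∑ i, (K i)† (K i) ≤ 1` is allowed, outcomes may be discarded (trace-nonincreasing
operations), and with the outcome `i` a sign `s i = ±1` is recorded, by which the result is
weighted. So the local operations are the differences `E⁺ - E⁻` of completely positive maps for
which `E⁺ + E⁻` is trace-nonincreasing.

Every completely positive map has a Kraus decomposition, and an outcome on which the rest of the
protocol does not depend is not used, so that the restriction to one Kraus operator per outcome
is no loss of generality. -/
inductive IsLOCC {A' B' : Type} : {A B : Type} → SuperOp (A × B) (A' × B') → Prop
  | done : IsLOCC (A := A') (B := B') LinearMap.id
  | alice {A B : Type} [Fintype A] [Fintype B] [DecidableEq A] [DecidableEq B]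
      {m : ℕ} {C : Fin m → Type} [∀ i, Fintype (C i)]
      (K : ∀ i, Matrix (C i) A ℂ)
      (hK : (1 - ∑ i, (K i).conjTranspose * K i).PosSemidef)
      (s : Fin m → ℤˣ)
      (P : ∀ i, SuperOp (C i × B) (A' × B'))
      (hP : ∀ i, IsLOCC (P i)) :
      IsLOCC (A := A) (B := B)
        (∑ i, (((s i : ℤˣ) : ℤ) : ℂ) • (P i ∘ₗ conjMap (K i ⊗ₖ (1 : Matrix B B ℂ))))
  | bob {A B : Type} [Fintype A] [Fintype B] [DecidableEq A] [DecidableEq B]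
      {m : ℕ} {C : Fin m → Type} [∀ i, Fintype (C i)]
      (K : ∀ i, Matrix (C i) B ℂ)
      (hK : (1 - ∑ i, (K i).conjTranspose * K i).PosSemidef)
      (s : Fin m → ℤˣ)
      (P : ∀ i, SuperOp (A × C i) (A' × B'))
      (hP : ∀ i, IsLOCC (P i)) :
      IsLOCC (A := A) (B := B)
        (∑ i, (((s i : ℤˣ) : ℤ) : ℂ) • (P i ∘ₗ conjMap ((1 : Matrix A A ℂ) ⊗ₖ K i)))

/-- The set `LOCC(A, B)` of superoperators on `A ⊗ B`. -/
def LOCC (A B : Type) : Set (SuperOp (A × B) (A × B)) := {E | IsLOCC E}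

/-! ### Quasiprobability decompositions and parallel wire cuts -/

/-- The one-norms `∑ i, |a i|` of the quasiprobability decompositions `U = ∑ i, a i • F i`, with
at least one term, of `U` into elements of `S`. The `γ`-factor `γ_S(U)` is the least element of
this set. -/
def qpdNorms {ι κ : Type} (S : Set (SuperOp ι κ)) (U : SuperOp ι κ) : Set ℝ :=
  {x | ∃ m : ℕ, 1 ≤ m ∧ ∃ (a : Fin m → ℝ) (F : Fin m → SuperOp ι κ),
    (∀ i, F i ∈ S) ∧ U = ∑ i, (a i : ℂ) • F i ∧ x = ∑ i, |a i|}

/-- The map `Γ` with `Γ[E](X) = tr_A E(X ⊗ |z⟩⟨z|)`, where `B` is a copy of the system `A`, and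
`|z⟩` is the initial state of `B`. -/
def Gam {A : Type} [Fintype A] [DecidableEq A] (z : A) (E : SuperOp (A × A) (A × A)) :
    SuperOp A A :=
  partialTraceFst ∘ₗ E ∘ₗ adjoinBasisState A z

/-- The image of `LOCC(A, B)` under `Γ`, for `A` and `B` two systems of `n` qubits. The initial
state of `B` is the all-zero state. -/
def cutLOCC (n : ℕ) : Set (SuperOp (Qubits n) (Qubits n)) :=
  Gam (0 : Qubits n) '' LOCC (Qubits n) (Qubits n)

/-! ### Wire cuts at arbitrary positions -/

/-- The direction in which a cut wire passes from one computer to the other. -/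
inductive Dir : Type
  | aToB
  | bToA

/-- Circuits on two computers, which hold the systems `A` and `B` at the beginning and `A'` and
`B'` at the end. Each step is a local channel on one of the computers (in Kraus form; local
unitaries, measurements, the preparation of ancillas and the discarding of systems are special
cases), or passes one qubit from one computer to the other. The latter are the wires that have to
be cut; the list records their directions in the order in which they occur. -/
inductive Circuit (A' B' : Type) : List Dir → Type → Type → Type 1
  | done : Circuit A' B' [] A' B'
  | gateA {w : List Dir} {A B C : Type} [Fintype A] [Fintype B] [Fintype C]
      [DecidableEq A] [DecidableEq B]
      {m : ℕ} (K : Fin m → Matrix C A ℂ) (hK : ∑ i, (K i).conjTranspose * K i = 1)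
      (c : Circuit A' B' w C B) : Circuit A' B' w A B
  | gateB {w : List Dir} {A B C : Type} [Fintype A] [Fintype B] [Fintype C]
      [DecidableEq A] [DecidableEq B]
      {m : ℕ} (K : Fin m → Matrix C B ℂ) (hK : ∑ i, (K i).conjTranspose * K i = 1)
      (c : Circuit A' B' w A C) : Circuit A' B' w A B
  | wireAB {w : List Dir} {A B : Type} (c : Circuit A' B' w A (Qubit × B)) :
      Circuit A' B' (Dir.aToB :: w) (Qubit × A) B
  | wireBA {w : List Dir} {A B : Type} (c : Circuit A' B' w (Qubit × A) B) :
      Circuit A' B' (Dir.bToA :: w) A (Qubit × B)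

/-- A joint replacement of wire cuts, whose directions are given by the list, by operations in
LOCC. The two computers have memories `MA` and `MB` next to the systems of the circuit. At each
cut, in place of passing the qubit, they perform an operation in LOCC on that qubit and on their
memories. At the end the memories are trivial. -/
inductive Replacement : List Dir → Type → Type → Type 1
  | done : Replacement [] Unit Unit
  | wireAB {w : List Dir} {MA MB MA' MB' : Type} [Fintype MA'] [Fintype MB']
      (E : SuperOp ((Qubit × MA) × MB) (MA' × (Qubit × MB'))) (hE : IsLOCC E)
      (σ : Replacement w MA' MB') : Replacement (Dir.aToB :: w) MA MB
  | wireBA {w : List Dir} {MA MB MA' MB' : Type} [Fintype MA'] [Fintype MB']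
      (E : SuperOp (MA × (Qubit × MB)) ((Qubit × MA') × MB')) (hE : IsLOCC E)
      (σ : Replacement w MA' MB') : Replacement (Dir.bToA :: w) MA MB

/-- The channel that a local channel on the first computer induces on both. -/
def localA {A B C : Type} [Fintype A] [Fintype B] [DecidableEq B] {m : ℕ}
    (K : Fin m → Matrix C A ℂ) : SuperOp (A × B) (C × B) :=
  ∑ i, conjMap (K i ⊗ₖ (1 : Matrix B B ℂ))

/-- The channel that a local channel on the second computer induces on both. -/
def localB {A B C : Type} [Fintype A] [Fintype B] [DecidableEq A] {m : ℕ}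
    (K : Fin m → Matrix C B ℂ) : SuperOp (A × B) (A × C) :=
  ∑ i, conjMap ((1 : Matrix A A ℂ) ⊗ₖ K i)

/-- The tensor factor `Q` moves from the first computer to the second. -/
def moveEquiv (Q A B : Type) : (Q × A) × B ≃ A × (Q × B) where
  toFun p := (p.1.2, (p.1.1, p.2))
  invFun p := ((p.2.1, p.1), p.2.2)
  left_inv _ := rfl
  right_inv _ := rfl

/-- The channel of a circuit in which the wires are not cut. -/
def Circuit.ideal {A' B' : Type} : {w : List Dir} → {A B : Type} → Circuit A' B' w A B →
    SuperOp (A × B) (A' × B')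
  | _, _, _, .done => LinearMap.id
  | _, _, _, @Circuit.gateA _ _ _ _ B _ _ _ _ _ _ _ K _ c => c.ideal ∘ₗ localA (B := B) K
  | _, _, _, @Circuit.gateB _ _ _ A _ _ _ _ _ _ _ _ K _ c => c.ideal ∘ₗ localB (A := A) K
  | _, _, _, .wireAB c => c.ideal ∘ₗ relabel (moveEquiv _ _ _).symm
  | _, _, _, .wireBA c => c.ideal ∘ₗ relabel (moveEquiv _ _ _)

/-- Reordering of tensor factors: `Q` moves from the first system of the circuit to the first
memory. -/
def shiftA (MA MB Q A B : Type) : (MA × MB) × ((Q × A) × B) ≃ ((Q × MA) × MB) × (A × B) where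
  toFun p := (((p.2.1.1, p.1.1), p.1.2), (p.2.1.2, p.2.2))
  invFun p := ((p.1.1.2, p.1.2), ((p.1.1.1, p.2.1), p.2.2))
  left_inv _ := rfl
  right_inv _ := rfl

/-- Reordering of tensor factors: `Q` moves from the second system of the circuit to the second
memory. -/
def shiftB (MA MB Q A B : Type) : (MA × MB) × (A × (Q × B)) ≃ (MA × (Q × MB)) × (A × B) where
  toFun p := ((p.1.1, (p.2.2.1, p.1.2)), (p.2.1, p.2.2.2))
  invFun p := ((p.1.1, p.1.2.2), (p.2.1, (p.1.2.1, p.2.2)))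
  left_inv _ := rfl
  right_inv _ := rfl

/-- Trivial memories may be omitted. -/
def unitEquiv (ι : Type) : ι ≃ (Unit × Unit) × ι where
  toFun i := (((), ()), i)
  invFun p := p.2
  left_inv _ := rfl
  right_inv _ := rfl

/-- The map, on the memories and the systems of the circuit, that results if the wires of a
circuit are cut and replaced. The gates act as before, and the operation that replaces a wire acts
on the qubit of that wire and on the memories. -/
def Circuit.run {A' B' : Type} : {w : List Dir} → {A B MA MB : Type} → Circuit A' B' w A B →
    Replacement w MA MB → SuperOp ((MA × MB) × (A × B)) (A' × B')
  | _, _, _, _, _, .done, .done => relabel (unitEquiv (A' × B'))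
  | _, _, _, _, _, @Circuit.gateA _ _ _ _ B _ _ _ _ _ _ _ K _ c, σ =>
      c.run σ ∘ₗ idTensor _ (localA (B := B) K)
  | _, _, _, _, _, @Circuit.gateB _ _ _ A _ _ _ _ _ _ _ _ K _ c, σ =>
      c.run σ ∘ₗ idTensor _ (localB (A := A) K)
  | _, _, _, _, _, .wireAB c, @Replacement.wireAB _ _ _ _ _ _ _ E _ σ =>
      c.run σ ∘ₗ relabel (shiftB _ _ _ _ _) ∘ₗ tensorId _ E ∘ₗ relabel (shiftA _ _ _ _ _).symm
  | _, _, _, _, _, .wireBA c, @Replacement.wireBA _ _ _ _ _ _ _ E _ σ =>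
      c.run σ ∘ₗ relabel (shiftA _ _ _ _ _) ∘ₗ tensorId _ E ∘ₗ relabel (shiftB _ _ _ _ _).symm

/-- The map that a circuit realises if its wires are cut and replaced, where the memories are
trivial at the beginning. -/
def Circuit.simulate {A' B' : Type} {w : List Dir} {A B : Type} (c : Circuit A' B' w A B)
    (σ : Replacement w Unit Unit) : SuperOp (A × B) (A' × B') :=
  c.run σ ∘ₗ relabel (unitEquiv (A × B)).symm

/-- The one-norms `∑ i, |a i|` of the quasiprobability decompositions, with at least one term, of
cut wires with the directions `w` at arbitrary positions in a circuit into joint replacements by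
operations in LOCC. A decomposition is valid if it reproduces every circuit in which wires with
these directions are cut, whatever is done before, between, after and next to the cuts. -/
def cutNorms (w : List Dir) : Set ℝ :=
  {x | ∃ m : ℕ, 1 ≤ m ∧ ∃ (a : Fin m → ℝ) (σ : Fin m → Replacement w Unit Unit),
    (∀ (A B A' B' : Type) [Fintype A] [Fintype B] [Fintype A'] [Fintype B']
      (c : Circuit A' B' w A B), c.ideal = ∑ i, (a i : ℂ) • c.simulate (σ i)) ∧
    x = ∑ i, |a i|}

/-- The sampling overhead of a quasiprobability decomposition is the square of its one-norm. -/
def samplingOverheads (N : Set ℝ) : Set ℝ := (fun x => x ^ 2) '' N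

end WireCut

open scoped Kronecker ComplexOrder

namespace WireCut

/-! ### Pure states and product vectors -/

/-! Write `d = 2 ^ n`, and let `Ω = ∑ i, |ii⟩` be the unnormalised maximally entangled vector.

Lower bound: on a product vector `u ⊗ v` the functional `W(X) = 2⟨Ω|X|Ω⟩ - tr X` is `2|∑ i, u i * v
i|² - ‖u‖²‖v‖²`, so by Cauchy-Schwarz its modulus is at most `‖u‖²‖v‖²`. A Kraus operator of one
party sends product vectors to product vectors, the squared norms of the branches add up to at most
the original one, and signs disappear in absolute values. Hence signed LOCC maps preserve this bound
(`IsLOCC.boundedOnProducts`). The normalised maximally entangled state has `W = 2d - 1`. If a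
decomposition reproduces it from a product input, then `∑ |a i| ≥ 2d - 1`. Parallel wires create it
by transmitting one half of it, and wires at arbitrary positions by transmitting half of one Bell
pair each (`exists_circuit_ideal_bellState`).

Upper bound: `|Ω⟩⟨Ω| = d P - (d - 1) Q`, where `P` and `Q` are Choi operators of measure-and-prepare
channels (`exists_bellVec_decomposition`), and `d + (d - 1) = 2d - 1`. Read as channels, `P` and `Q`
need only one-way communication, which settles parallel cuts. Read as states, `P / d` and `Q / d`
are separable, so LOCC can load them into the memories before the first cut. All wires are then
replaced by teleportation through the memories. The result is linear in the memory state, so the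
combination acts as teleportation with perfect Bell pairs, that is, as the uncut circuit. -/

/-- The operator `|ψ⟩⟨ψ|`. -/
def pureState {ι : Type} (ψ : ι → ℂ) : Op ι := Matrix.vecMulVec ψ (star ψ)

theorem pureState_apply {ι : Type} (ψ : ι → ℂ) (i j : ι) :
    pureState ψ i j = ψ i * star (ψ j) := rfl

theorem conjMap_apply {ι κ : Type} [Fintype ι] (K : Matrix κ ι ℂ) (X : Op ι) :
    conjMap K X = K * X * K.conjTranspose := rfl

theorem conjMap_pureState {ι κ : Type} [Fintype ι] (K : Matrix κ ι ℂ) (ψ : ι → ℂ) :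
    conjMap K (pureState ψ) = pureState (K.mulVec ψ) := by
  rw [conjMap_apply, pureState, pureState, Matrix.mul_vecMulVec, Matrix.vecMulVec_mul,
    Matrix.star_mulVec]

theorem conjMap_comp {ι κ μ : Type} [Fintype ι] [Fintype κ] (L : Matrix μ κ ℂ)
    (K : Matrix κ ι ℂ) : conjMap L ∘ₗ conjMap K = conjMap (L * K) := by
  ext1 X
  simp [conjMap_apply, Matrix.conjTranspose_mul, Matrix.mul_assoc]

theorem relabel_pureState {ι κ : Type} (e : κ ≃ ι) (ψ : ι → ℂ) :
    relabel e (pureState ψ) = pureState (ψ ∘ e) := rfl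

theorem tensorId_comp (R : Type) {ι κ μ : Type} (F : SuperOp κ μ) (E : SuperOp ι κ) :
    tensorId R (F ∘ₗ E) = tensorId R F ∘ₗ tensorId R E := rfl

theorem tensorId_id (R : Type) {ι : Type} :
    tensorId R (LinearMap.id : SuperOp ι ι) = LinearMap.id := rfl

theorem tensorId_sum (R : Type) {ι κ T : Type} (s : Finset T) (E : T → SuperOp ι κ) :
    tensorId R (∑ t ∈ s, E t) = ∑ t ∈ s, tensorId R (E t) := by
  ext X p q
  simp [tensorId, LinearMap.sum_apply, Matrix.sum_apply]

theorem tensorId_smul (R : Type) {ι κ : Type} (c : ℂ) (E : SuperOp ι κ) :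
    tensorId R (c • E) = c • tensorId R E := rfl

/-- The action of `K ⊗ 1` on vectors. -/
def applyFst {C A R : Type} [Fintype A] (K : Matrix C A ℂ) (u : A × R → ℂ) : C × R → ℂ :=
  fun p => ∑ a, K p.1 a * u (a, p.2)

theorem tensorId_conjMap_pureState {ι κ R : Type} [Fintype ι] (K : Matrix κ ι ℂ)
    (ψ : ι × R → ℂ) :
    tensorId R (conjMap K) (pureState ψ) = pureState (applyFst K ψ) := by
  ext p q
  change (K * Matrix.vecMulVec (fun i => ψ (i, p.2)) (star fun i => ψ (i, q.2)) *
    K.conjTranspose) p.1 q.1 = _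
  rw [Matrix.mul_vecMulVec, Matrix.vecMulVec_mul, ← Matrix.star_mulVec]
  rfl

/-- The product of the vectors `u` and `v`, on systems `A`, `B` and references `R`, `S`. -/
def jointVec {A B R S : Type} (u : A × R → ℂ) (v : B × S → ℂ) : (A × B) × (R × S) → ℂ :=
  fun p => u (p.1.1, p.2.1) * v (p.1.2, p.2.2)

theorem applyFst_kronecker_one {A B C R S : Type} [Fintype A] [Fintype B] [DecidableEq B]
    (K : Matrix C A ℂ) (u : A × R → ℂ) (v : B × S → ℂ) :
    applyFst (K ⊗ₖ (1 : Matrix B B ℂ)) (jointVec u v) = jointVec (applyFst K u) v := by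
  ext p
  simp only [applyFst, jointVec, Fintype.sum_prod_type, Matrix.kroneckerMap_apply,
    Matrix.one_apply, mul_ite, mul_one, mul_zero, ite_mul, zero_mul, Finset.sum_ite_eq,
    Finset.mem_univ, if_true, Finset.sum_mul, mul_assoc]

theorem applyFst_one_kronecker {A B C R S : Type} [Fintype A] [Fintype B] [DecidableEq A]
    (K : Matrix C B ℂ) (u : A × R → ℂ) (v : B × S → ℂ) :
    applyFst ((1 : Matrix A A ℂ) ⊗ₖ K) (jointVec u v) = jointVec u (applyFst K v) := by
  ext p
  simp only [applyFst, jointVec, Fintype.sum_prod_type_right, Matrix.kroneckerMap_apply,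
    Matrix.one_apply, ite_mul, one_mul, zero_mul, Finset.sum_ite_eq,
    Finset.mem_univ, if_true, Finset.mul_sum]
  exact Finset.sum_congr rfl fun _ _ => by ring

/-- The squared norm of a vector. -/
noncomputable def sqNorm {ι : Type} (u : ι → ℂ) : ℝ := ∑ᶠ i, Complex.normSq (u i)

/-- The `finsum` in `sqNorm` avoids `Fintype` instances on the output systems, which `IsLOCC` does
not carry. -/
theorem sqNorm_eq_sum {ι : Type} [Fintype ι] (u : ι → ℂ) :
    sqNorm u = ∑ i, Complex.normSq (u i) := finsum_eq_sum_of_fintype _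

theorem sqNorm_nonneg {ι : Type} (u : ι → ℂ) : 0 ≤ sqNorm u :=
  finsum_nonneg fun _ => Complex.normSq_nonneg _

theorem sqNorm_comp_equiv {ι κ : Type} (e : κ ≃ ι) (u : ι → ℂ) : sqNorm (u ∘ e) = sqNorm u :=
  finsum_comp_equiv (f := fun i => Complex.normSq (u i)) e

/-- This is positivity of `1 - ∑ K†K` in the vector `x`. -/
theorem sum_normSq_mulVec_le {A : Type} [Fintype A] [DecidableEq A] {m : ℕ} {C : Fin m → Type}
    [∀ i, Fintype (C i)] (K : ∀ i, Matrix (C i) A ℂ)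
    (hK : (1 - ∑ i, (K i).conjTranspose * K i).PosSemidef) (x : A → ℂ) :
    ∑ i, ∑ c, Complex.normSq ((K i).mulVec x c) ≤ ∑ a, Complex.normSq (x a) := by
  have key : ∀ {ι : Type} [Fintype ι] (y : ι → ℂ),
      star y ⬝ᵥ y = ((∑ a, Complex.normSq (y a) : ℝ) : ℂ) := by
    intro ι _ y
    simp [dotProduct, Complex.normSq_eq_conj_mul_self]
  have h := hK.dotProduct_mulVec_nonneg x
  rw [Matrix.sub_mulVec, Matrix.one_mulVec, dotProduct_sub, Matrix.sum_mulVec, dotProduct_sum,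
    key] at h
  have h2 : ∀ i, star x ⬝ᵥ ((K i).conjTranspose * K i).mulVec x
      = ((∑ c, Complex.normSq ((K i).mulVec x c) : ℝ) : ℂ) := by
    intro i
    rw [← key, ← Matrix.mulVec_mulVec, Matrix.dotProduct_mulVec, Matrix.star_mulVec]
  simp only [h2] at h
  rw [← Complex.ofReal_sum, ← Complex.ofReal_sub] at h
  linarith [Complex.zero_le_real.mp h]

theorem sum_sqNorm_applyFst_le {A R : Type} [Fintype A] [DecidableEq A] [Finite R] {m : ℕ}
    {C : Fin m → Type} [∀ i, Fintype (C i)] (K : ∀ i, Matrix (C i) A ℂ)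
    (hK : (1 - ∑ i, (K i).conjTranspose * K i).PosSemidef) (u : A × R → ℂ) :
    ∑ i, sqNorm (applyFst (K i) u) ≤ sqNorm u := by
  cases nonempty_fintype R
  simp only [sqNorm_eq_sum, Fintype.sum_prod_type_right]
  rw [Finset.sum_comm]
  exact Finset.sum_le_sum fun r _ => sum_normSq_mulVec_le K hK fun a => u (a, r)

/-! ### LOCC maps do not increase functionals that are bounded on product states -/

/-- The functional `g` is bounded by the trace on pure product states. -/
def BoundedOnProducts {A B R S : Type} (g : Op ((A × B) × (R × S)) →ₗ[ℂ] ℂ) : Prop :=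
  ∀ (u : A × R → ℂ) (v : B × S → ℂ), ‖g (pureState (jointVec u v))‖ ≤ sqNorm u * sqNorm v

theorem norm_sign_le (s : ℤˣ) (z : ℂ) : ‖(((s : ℤˣ) : ℤ) : ℂ) * z‖ ≤ ‖z‖ := by
  rcases Int.units_eq_one_or s with rfl | rfl <;> simp

/-- The reference `R` belongs to Alice and `S` to Bob, so entanglement within one side is allowed.
Each round replaces one factor by its branches; the triangle inequality removes the signs, and the
branch norms sum to at most the original norm. -/
theorem IsLOCC.boundedOnProducts {A' B' R S : Type} [Finite R] [Finite S]
    (g : Op ((A' × B') × (R × S)) →ₗ[ℂ] ℂ) (hg : BoundedOnProducts g)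
    {A B : Type} {E : SuperOp (A × B) (A' × B')} (hE : IsLOCC E) :
    BoundedOnProducts (g ∘ₗ tensorId (R × S) E) := by
  induction hE with
  | done => exact hg
  | alice K hK s P hP ih =>
    intro u v
    simp only [tensorId_sum, tensorId_smul, tensorId_comp, LinearMap.comp_apply,
      LinearMap.sum_apply, LinearMap.smul_apply, map_sum, map_smul, tensorId_conjMap_pureState,
      applyFst_kronecker_one, smul_eq_mul]
    calc _ ≤ ∑ i, sqNorm (applyFst (K i) u) * sqNorm v :=
          (norm_sum_le _ _).trans (Finset.sum_le_sum fun i _ =>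
            (norm_sign_le _ _).trans (ih i _ _))
      _ ≤ _ := by
          rw [← Finset.sum_mul]
          exact mul_le_mul_of_nonneg_right (sum_sqNorm_applyFst_le K hK u) (sqNorm_nonneg v)
  | bob K hK s P hP ih =>
    intro u v
    simp only [tensorId_sum, tensorId_smul, tensorId_comp, LinearMap.comp_apply,
      LinearMap.sum_apply, LinearMap.smul_apply, map_sum, map_smul, tensorId_conjMap_pureState,
      applyFst_one_kronecker, smul_eq_mul]
    calc _ ≤ ∑ i, sqNorm u * sqNorm (applyFst (K i) v) :=
          (norm_sum_le _ _).trans (Finset.sum_le_sum fun i _ =>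
            (norm_sign_le _ _).trans (ih i _ _))
      _ ≤ _ := by
          rw [← Finset.mul_sum]
          exact mul_le_mul_of_nonneg_left (sum_sqNorm_applyFst_le K hK v) (sqNorm_nonneg u)

/-! ### Protocols without signs -/

/-- All protocols constructed below use only the sign `+1`; negative weights occur in the
coefficients of the decompositions alone. -/
theorem IsLOCC.alice_sum {A B C A' B' T : Type} [Fintype A] [Fintype B] [Fintype C]
    [DecidableEq A] [DecidableEq B] [Fintype T] (K : T → Matrix C A ℂ)
    (hK : ∑ t, (K t).conjTranspose * K t = 1) (P : T → SuperOp (C × B) (A' × B'))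
    (hP : ∀ t, IsLOCC (P t)) :
    IsLOCC (∑ t, P t ∘ₗ conjMap (K t ⊗ₖ (1 : Matrix B B ℂ))) := by
  let e := Fintype.equivFin T
  have h := IsLOCC.alice (B := B) (fun i => K (e.symm i))
    (by rw [e.symm.sum_comp (fun t => (K t).conjTranspose * K t), hK, sub_self]; exact .zero)
    (fun _ => 1) (fun i => P (e.symm i)) (fun i => hP _)
  simp only [Units.val_one, Int.cast_one, one_smul] at h
  rwa [e.symm.sum_comp (fun t => P t ∘ₗ conjMap (K t ⊗ₖ (1 : Matrix B B ℂ)))] at h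

theorem IsLOCC.bob_sum {A B C A' B' T : Type} [Fintype A] [Fintype B] [Fintype C]
    [DecidableEq A] [DecidableEq B] [Fintype T] (K : T → Matrix C B ℂ)
    (hK : ∑ t, (K t).conjTranspose * K t = 1) (P : T → SuperOp (A × C) (A' × B'))
    (hP : ∀ t, IsLOCC (P t)) :
    IsLOCC (∑ t, P t ∘ₗ conjMap ((1 : Matrix A A ℂ) ⊗ₖ K t)) := by
  let e := Fintype.equivFin T
  have h := IsLOCC.bob (A := A) (fun i => K (e.symm i))
    (by rw [e.symm.sum_comp (fun t => (K t).conjTranspose * K t), hK, sub_self]; exact .zero)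
    (fun _ => 1) (fun i => P (e.symm i)) (fun i => hP _)
  simp only [Units.val_one, Int.cast_one, one_smul] at h
  rwa [e.symm.sum_comp (fun t => P t ∘ₗ conjMap ((1 : Matrix A A ℂ) ⊗ₖ K t))] at h

theorem IsLOCC.bob_single {A B C A' B' : Type} [Fintype A] [Fintype B] [Fintype C]
    [DecidableEq A] [DecidableEq B] (K : Matrix C B ℂ)
    (hK : (1 - K.conjTranspose * K).PosSemidef) {P : SuperOp (A × C) (A' × B')} (hP : IsLOCC P) :
    IsLOCC (P ∘ₗ conjMap ((1 : Matrix A A ℂ) ⊗ₖ K)) := by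
  have h := IsLOCC.bob (A := A) (fun _ : Fin 1 => K) (by simpa using hK) (fun _ => 1)
    (fun _ => P) (fun _ => hP)
  simpa using h

theorem IsLOCC.alice_single {A B C A' B' : Type} [Fintype A] [Fintype B] [Fintype C]
    [DecidableEq A] [DecidableEq B] (K : Matrix C A ℂ)
    (hK : (1 - K.conjTranspose * K).PosSemidef) {P : SuperOp (C × B) (A' × B')} (hP : IsLOCC P) :
    IsLOCC (P ∘ₗ conjMap (K ⊗ₖ (1 : Matrix B B ℂ))) := by
  have h := IsLOCC.alice (B := B) (fun _ : Fin 1 => K) (by simpa using hK) (fun _ => 1)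
    (fun _ => P) (fun _ => hP)
  simpa using h

theorem isLOCC_localA {A B C : Type} [Fintype A] [Fintype B] [Fintype C] [DecidableEq A]
    [DecidableEq B] {m : ℕ} (K : Fin m → Matrix C A ℂ)
    (hK : ∑ i, (K i).conjTranspose * K i = 1) : IsLOCC (localA (B := B) K) :=
  IsLOCC.alice_sum K hK (fun _ => LinearMap.id) fun _ => .done

theorem isLOCC_localB {A B C : Type} [Fintype A] [Fintype B] [Fintype C] [DecidableEq A]
    [DecidableEq B] {m : ℕ} (K : Fin m → Matrix C B ℂ)
    (hK : ∑ i, (K i).conjTranspose * K i = 1) : IsLOCC (localB (A := A) K) :=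
  IsLOCC.bob_sum K hK (fun _ => LinearMap.id) fun _ => .done

/-! ### The witness for the maximally entangled state -/

/-- The tensor product of two vectors. -/
def prodVec {A B : Type} (u : A → ℂ) (v : B → ℂ) : A × B → ℂ := fun p => u p.1 * v p.2

/-- The unnormalised maximally entangled vector. -/
def bellVec (ι : Type) [DecidableEq ι] : ι × ι → ℂ := fun p => if p.1 = p.2 then 1 else 0

/-- The functional `X ↦ 2 d ⟨Φ|X|Φ⟩ - tr X`, where `Φ` is the normalised maximally entangled
state of two systems of dimension `d`. -/
def bellWitness (ι : Type) [Fintype ι] : Op (ι × ι) →ₗ[ℂ] ℂ where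
  toFun X := 2 * ∑ i, ∑ j, X (i, i) (j, j) - ∑ i, ∑ j, X (i, j) (i, j)
  map_add' X Y := by
    simp only [Matrix.add_apply, Finset.sum_add_distrib]
    ring
  map_smul' c X := by
    simp only [Matrix.smul_apply, smul_eq_mul, ← Finset.mul_sum, RingHom.id_apply]
    ring

theorem bellWitness_apply {ι : Type} [Fintype ι] (X : Op (ι × ι)) :
    bellWitness ι X = 2 * ∑ i, ∑ j, X (i, i) (j, j) - ∑ i, ∑ j, X (i, j) (i, j) := rfl

theorem bellWitness_bellVec (ι : Type) [Fintype ι] [DecidableEq ι] :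
    bellWitness ι (pureState (bellVec ι)) =
      (Fintype.card ι : ℂ) * (2 * Fintype.card ι - 1) := by
  have h : ∀ i j : ι, pureState (bellVec ι) (i, j) (i, j) = if i = j then 1 else 0 := by
    intro i j
    by_cases hij : i = j <;> simp [pureState_apply, bellVec, hij]
  have h' : ∀ i j : ι, pureState (bellVec ι) (i, i) (j, j) = 1 := by
    simp [pureState_apply, bellVec]
  simp only [bellWitness_apply, h, h', Finset.sum_ite_eq, Finset.mem_univ, if_true,
    Finset.sum_const, Finset.card_univ, nsmul_eq_mul, mul_one]
  ring

theorem normSq_sum_mul_le {ι : Type} [Fintype ι] (u v : ι → ℂ) :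
    Complex.normSq (∑ i, u i * v i) ≤ sqNorm u * sqNorm v := by
  simp only [sqNorm_eq_sum, Complex.normSq_eq_norm_sq]
  calc ‖∑ i, u i * v i‖ ^ 2 ≤ (∑ i, ‖u i‖ * ‖v i‖) ^ 2 := by
        gcongr
        exact (norm_sum_le _ _).trans_eq (by simp)
    _ ≤ _ := Finset.sum_mul_sq_le_sq_mul_sq _ _ _

/-- The factor 2 in the witness makes the range symmetric: the overlap `|∑ i, u i * v i|²` lies
between `0` and `‖u‖²‖v‖²`. -/
theorem norm_bellWitness_le {ι : Type} [Fintype ι] (u v : ι → ℂ) :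
    ‖bellWitness ι (pureState (prodVec u v))‖ ≤ sqNorm u * sqNorm v := by
  have h : bellWitness ι (pureState (prodVec u v)) =
      ((2 * Complex.normSq (∑ i, u i * v i) - sqNorm u * sqNorm v : ℝ) : ℂ) := by
    rw [bellWitness_apply]
    push_cast
    congr 1
    · rw [← Complex.mul_conj, map_sum, Finset.sum_mul_sum]
      rfl
    · simp only [sqNorm_eq_sum, Complex.ofReal_sum, Finset.sum_mul_sum]
      refine Finset.sum_congr rfl fun i _ => Finset.sum_congr rfl fun j _ => ?_
      simp only [← Complex.mul_conj, pureState_apply, prodVec, star_mul', RCLike.star_def]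
      ring
  rw [h, Complex.norm_real, Real.norm_eq_abs, abs_le]
  have h1 := normSq_sum_mul_le u v
  have h2 := Complex.normSq_nonneg (∑ i, u i * v i)
  constructor <;> linarith

/-! ### Lower bound for parallel cuts -/

/-- The functional `X ↦ W (tr_A X)` for the witness `W` on `B` and a reference of `A`. -/
def tracedWitness (ι : Type) [Fintype ι] : Op ((ι × ι) × (ι × Unit)) →ₗ[ℂ] ℂ :=
  bellWitness ι ∘ₗ relabel ((Equiv.refl ι).prodCongr (Equiv.prodPUnit ι).symm) ∘ₗ
    tensorId (ι × Unit) partialTraceFst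

/-- Tracing out `A` turns `u ⊗ v` into a sum of product states, one for each basis index of `A`,
whose squared norms add up to that of `u ⊗ v`. -/
theorem boundedOnProducts_tracedWitness (ι : Type) [Fintype ι] :
    BoundedOnProducts (tracedWitness ι) := by
  intro u v
  have h : tracedWitness ι (pureState (jointVec u v)) =
      ∑ a, bellWitness ι
        (pureState (prodVec (fun b => v (b, ())) (fun r => u (a, (r, ()).1)))) := by
    rw [← map_sum]
    refine congrArg (bellWitness ι) ?_
    ext p q
    rw [Matrix.sum_apply]
    refine Finset.sum_congr rfl fun a _ => ?_
    simp only [pureState_apply, jointVec, prodVec, Matrix.of_apply, Equiv.prodCongr_apply,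
      Prod.map, Equiv.refl_apply, Equiv.prodPUnit_symm_apply, mul_comm (v _)]
  have hv : sqNorm (fun b => v (b, ())) = sqNorm v :=
    sqNorm_comp_equiv (Equiv.prodPUnit ι).symm v
  rw [h]
  calc _ ≤ ∑ a, sqNorm v * sqNorm (fun r => u (a, r)) :=
        (norm_sum_le _ _).trans (Finset.sum_le_sum fun a _ => hv ▸ norm_bellWitness_le _ _)
    _ = _ := by
        rw [← Finset.mul_sum, mul_comm]
        simp only [sqNorm_eq_sum, Fintype.sum_prod_type]

theorem sqNorm_bellVec (ι : Type) [Fintype ι] [DecidableEq ι] :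
    sqNorm (bellVec ι) = Fintype.card ι := by
  rw [sqNorm_eq_sum, Fintype.sum_prod_type]
  simp [bellVec, apply_ite]

/-- The input is a product between the two sides: `Ω` lies on `A` and its reference, both with
Alice, and Bob holds `|z⟩` with a trivial reference. The bound is the squared norm of `Ω`. -/
theorem norm_bellWitness_Gam_le {ι : Type} [Fintype ι] [DecidableEq ι] (z : ι)
    {E : SuperOp (ι × ι) (ι × ι)} (hE : IsLOCC E) :
    ‖bellWitness ι (tensorId ι (Gam z E) (pureState (bellVec ι)))‖ ≤ Fintype.card ι := by
  let v : ι × Unit → ℂ := fun p => if z = p.1 then 1 else 0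
  have hv : sqNorm v = 1 := by
    rw [sqNorm_eq_sum, Fintype.sum_prod_type]
    simp [v, apply_ite]
  have h := hE.boundedOnProducts (tracedWitness ι) (boundedOnProducts_tracedWitness ι)
    (bellVec ι) v
  rw [sqNorm_bellVec, hv, mul_one] at h
  refine le_of_eq_of_le (congrArg norm ?_) h
  refine congrArg (bellWitness ι) ?_
  ext p q
  change ∑ a, E (adjoinBasisState ι z (Matrix.of fun i j =>
      pureState (bellVec ι) (i, p.2) (j, q.2))) (a, p.1) (a, q.1) =
    ∑ a, E (Matrix.of fun i j => pureState (jointVec (bellVec ι) v) (i, (p.2, ()))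
      (j, (q.2, ()))) (a, p.1) (a, q.1)
  refine Finset.sum_congr rfl fun a _ => congrFun (congrFun (congrArg E ?_) _) _
  ext ⟨i, i'⟩ ⟨j, j'⟩
  by_cases h1 : z = i' <;> by_cases h2 : z = j' <;> try subst h1 <;> try subst h2
  all_goals simp_all [adjoinBasisState, pureState_apply, jointVec, v, - RCLike.star_def]

theorem le_of_mem_qpdNorms {ι : Type} [Fintype ι] [DecidableEq ι] (z : ι) {x : ℝ}
    (hx : x ∈ qpdNorms (Gam z '' LOCC ι ι) LinearMap.id) :
    2 * (Fintype.card ι : ℝ) - 1 ≤ x := by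
  obtain ⟨m, -, a, F, hF, hU, rfl⟩ := hx
  have hd : (1 : ℝ) ≤ Fintype.card ι := by
    exact_mod_cast Fintype.card_pos_iff.mpr ⟨z⟩
  have h := bellWitness_bellVec ι
  -- The identity channel is inserted on one half of `Ω`, so that its decomposition can be
  -- substituted.
  rw [← LinearMap.id_apply (R := ℂ) (pureState (bellVec ι)), ← tensorId_id, hU, tensorId_sum,
    LinearMap.sum_apply, map_sum] at h
  have h2 := congrArg norm h
  have h3 : ‖(Fintype.card ι : ℂ) * (2 * Fintype.card ι - 1)‖
      = Fintype.card ι * (2 * (Fintype.card ι : ℝ) - 1) := by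
    have : (Fintype.card ι : ℂ) * (2 * Fintype.card ι - 1)
        = ((Fintype.card ι * (2 * (Fintype.card ι : ℝ) - 1) : ℝ) : ℂ) := by push_cast; rfl
    rw [this, Complex.norm_real, Real.norm_of_nonneg]
    exact mul_nonneg (by linarith) (by linarith)
  rw [h3] at h2
  have h4 : (Fintype.card ι : ℝ) * (2 * Fintype.card ι - 1) ≤ ∑ i, |a i| * Fintype.card ι := by
    rw [← h2]
    refine (norm_sum_le _ _).trans (Finset.sum_le_sum fun i _ => ?_)
    rw [tensorId_smul, LinearMap.smul_apply, map_smul, norm_smul, Complex.norm_real,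
      Real.norm_eq_abs]
    obtain ⟨E, hE, hEi⟩ := hF i
    rw [← hEi]
    exact mul_le_mul_of_nonneg_left (norm_bellWitness_Gam_le z hE) (abs_nonneg _)
  rw [← Finset.sum_mul, mul_comm] at h4
  exact le_of_mul_le_mul_right h4 (by linarith)

/-! ### Lower bound for cuts at arbitrary positions -/

/-- For a gate of the circuit the memories play the role of the references. -/
theorem idTensor_jointVec_bounded {MA MB A B A' B' : Type} [Finite MA] [Finite MB]
    (g : Op ((MA × MB) × (A' × B')) →ₗ[ℂ] ℂ) (hg : BoundedOnProducts g)
    {G : SuperOp (A × B) (A' × B')} (hG : IsLOCC G) :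
    BoundedOnProducts (g ∘ₗ idTensor (MA × MB) G) := by
  have swap : ∀ {A B R S : Type} (u : A × R → ℂ) (v : B × S → ℂ),
      jointVec u v ∘ Equiv.prodComm (R × S) (A × B) =
        jointVec (u ∘ Equiv.prodComm R A) (v ∘ Equiv.prodComm S B) := fun _ _ => rfl
  intro u v
  have h := hG.boundedOnProducts (R := MA) (S := MB)
    (g ∘ₗ relabel (Equiv.prodComm (MA × MB) (A' × B')))
    (fun u v => by
      rw [LinearMap.comp_apply, relabel_pureState, swap]
      refine (hg _ _).trans_eq ?_
      rw [sqNorm_comp_equiv, sqNorm_comp_equiv])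
    (u ∘ Equiv.prodComm A MA) (v ∘ Equiv.prodComm B MB)
  rw [sqNorm_comp_equiv, sqNorm_comp_equiv] at h
  exact h

/-- At a replaced wire the remaining systems of the circuit are the references. The cut qubit only
moves between circuit and memory of the same computer, which respects the product structure and the
norms. -/
theorem Circuit.boundedOnProducts_run {A' B' : Type} (g : Op (A' × B') →ₗ[ℂ] ℂ)
    (hg : ∀ u v, ‖g (pureState (prodVec u v))‖ ≤ sqNorm u * sqNorm v)
    {w : List Dir} {A B : Type} (c : Circuit A' B' w A B) :
    ∀ {MA MB : Type} [Finite MA] [Finite MB] [Finite A] [Finite B] (σ : Replacement w MA MB),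
      BoundedOnProducts (g ∘ₗ c.run σ) := by
  induction c with
  | done =>
    intro MA MB _ _ _ _ σ u v
    cases σ
    refine (hg (u ∘ (Equiv.punitProd A').symm) (v ∘ (Equiv.punitProd B').symm)).trans_eq ?_
    rw [sqNorm_comp_equiv, sqNorm_comp_equiv]
  | gateA K hK c ih =>
    intro MA MB _ _ _ _ σ
    exact idTensor_jointVec_bounded (g ∘ₗ c.run σ) (ih σ) (isLOCC_localA K hK)
  | gateB K hK c ih =>
    intro MA MB _ _ _ _ σ
    exact idTensor_jointVec_bounded (g ∘ₗ c.run σ) (ih σ) (isLOCC_localB K hK)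
  | @wireAB w A B c ih =>
    intro MA MB _ _ _ _ σ u v
    -- The wire constructors carry no instances, so finiteness is recovered from that of `Qubit ×
    -- A`.
    have : Finite A := .of_surjective (Prod.snd : Qubit × A → A) Prod.snd_surjective
    cases σ with
    | @wireAB _ _ _ MA' MB' _ _ E hE σ =>
      let eA : (Qubit × MA) × A ≃ MA × (Qubit × A) :=
        ⟨fun p => (p.1.2, (p.1.1, p.2)), fun p => ((p.2.1, p.1), p.2.2), fun _ => rfl,
          fun _ => rfl⟩
      let eB : MB' × (Qubit × B) ≃ (Qubit × MB') × B :=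
        ⟨fun p => ((p.2.1, p.1), p.2.2), fun p => (p.1.2, (p.1.1, p.2)), fun _ => rfl,
          fun _ => rfl⟩
      have h := hE.boundedOnProducts (g ∘ₗ c.run σ ∘ₗ relabel (shiftB _ _ _ _ _))
        (fun u v => (ih σ u (v ∘ eB)).trans_eq (by rw [sqNorm_comp_equiv])) (u ∘ eA) v
      rw [sqNorm_comp_equiv] at h
      exact h
  | @wireBA w A B c ih =>
    intro MA MB _ _ _ _ σ u v
    have : Finite B := .of_surjective (Prod.snd : Qubit × B → B) Prod.snd_surjective
    cases σ with
    | @wireBA _ _ _ MA' MB' _ _ E hE σ =>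
      let eB : (Qubit × MB) × B ≃ MB × (Qubit × B) :=
        ⟨fun p => (p.1.2, (p.1.1, p.2)), fun p => ((p.2.1, p.1), p.2.2), fun _ => rfl,
          fun _ => rfl⟩
      let eA : MA' × (Qubit × A) ≃ (Qubit × MA') × A :=
        ⟨fun p => ((p.2.1, p.1), p.2.2), fun p => (p.1.2, (p.1.1, p.2)), fun _ => rfl,
          fun _ => rfl⟩
      have h := hE.boundedOnProducts (g ∘ₗ c.run σ ∘ₗ relabel (shiftA _ _ _ _ _))
        (fun u v => (ih σ (u ∘ eA) v).trans_eq (by rw [sqNorm_comp_equiv])) u (v ∘ eB)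
      rw [sqNorm_comp_equiv] at h
      exact h

/-! ### Circuits that distribute Bell pairs -/

/-- The basis of `k` qubits, with the last qubit split off. -/
abbrev Mem : ℕ → Type
  | 0 => Unit
  | k + 1 => Qubit × Mem k

instance Mem.fintype : (k : ℕ) → Fintype (Mem k)
  | 0 => inferInstanceAs (Fintype Unit)
  | k + 1 => letI := Mem.fintype k; inferInstanceAs (Fintype (Qubit × Mem k))

instance Mem.decidableEq : (k : ℕ) → DecidableEq (Mem k)
  | 0 => inferInstanceAs (DecidableEq Unit)
  | k + 1 => letI := Mem.decidableEq k; inferInstanceAs (DecidableEq (Qubit × Mem k))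

theorem Mem.card (k : ℕ) : Fintype.card (Mem k) = 2 ^ k := by
  induction k with
  | zero => rfl
  | succ k ih =>
    rw [pow_succ', ← ih]
    exact Fintype.card_prod Qubit (Mem k)

/-- The number `1 / √2`. -/
noncomputable def invSqrtTwo : ℂ := ((Real.sqrt 2)⁻¹ : ℝ)

theorem star_invSqrtTwo : star invSqrtTwo = invSqrtTwo := Complex.conj_ofReal _

theorem invSqrtTwo_mul_self : invSqrtTwo * invSqrtTwo = 1 / 2 := by
  rw [invSqrtTwo, ← Complex.ofReal_mul, ← mul_inv, Real.mul_self_sqrt (by norm_num)]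
  norm_num

/-- The isometry that adjoins two qubits in the state `Φ`. -/
noncomputable def bellPrep (A : Type) [DecidableEq A] : Matrix (Qubit × (Qubit × A)) A ℂ :=
  fun p a => if p.1 = p.2.1 ∧ p.2.2 = a then invSqrtTwo else 0

theorem bellPrep_isometry (A : Type) [Fintype A] [DecidableEq A] :
    ∑ _i : Fin 1, (bellPrep A).conjTranspose * bellPrep A = 1 := by
  ext a b
  have h : ∀ (q q' : Qubit) (x : A), star (bellPrep A (q, (q', x)) a) * bellPrep A (q, (q', x)) b =
      if q = q' then (if x = a then (if a = b then 1 / 2 else 0) else 0) else 0 := by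
    intro q q' x
    by_cases h1 : q = q' <;> by_cases h2 : x = a
    · by_cases h3 : a = b <;>
        simp [bellPrep, h1, h2, h3, star_invSqrtTwo, invSqrtTwo_mul_self, - RCLike.star_def]
    all_goals simp [bellPrep, h1, h2]
  simp only [Finset.univ_unique, Finset.sum_singleton, Matrix.mul_apply,
    Matrix.conjTranspose_apply, Fintype.sum_prod_type, h, Matrix.one_apply]
  by_cases h3 : a = b <;> simp [h3]

/-- The maximally entangled state of `k` pairs of qubits. -/
noncomputable def bellState (k : ℕ) : Op (Mem k × Mem k) :=
  ((1 / 2 : ℂ) ^ k) • pureState (bellVec (Mem k))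

theorem pureState_smul {ι : Type} (c : ℂ) (ψ : ι → ℂ) :
    pureState (c • ψ) = (c * star c) • pureState ψ := by
  ext i j
  simp [pureState_apply]
  ring

/-- The new pair keeps its normalisation inside the vector, which is the form that `bellPrep`
produces. -/
theorem bellState_succ (k : ℕ) : bellState (k + 1) =
    ((1 / 2 : ℂ) ^ k) • pureState (invSqrtTwo • bellVec (Mem (k + 1))) := by
  rw [pureState_smul, star_invSqrtTwo, invSqrtTwo_mul_self, smul_smul, ← pow_succ, bellState]

/-- Before each wire the sender prepares a Bell pair, keeps one half and passes the other on. The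
direction does not matter because the pair is symmetric. -/
theorem exists_circuit_ideal_bellState (N : ℕ) (w : List Dir) : ∀ k : ℕ, k + w.length = N →
    ∃ c : Circuit (Mem N) (Mem N) w (Mem k) (Mem k), c.ideal (bellState k) = bellState N := by
  induction w with
  | nil =>
    rintro k rfl
    exact ⟨.done, rfl⟩
  | cons d w ih =>
    intro k hk
    obtain ⟨c, hc⟩ := ih (k + 1) (by simp at hk; omega)
    cases d with
    | aToB =>
      refine ⟨.gateA (fun _ : Fin 1 => bellPrep (Mem k)) (bellPrep_isometry _) (.wireAB c), ?_⟩
      rw [← hc]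
      refine congrArg c.ideal ?_
      rw [bellState_succ, bellState]
      simp only [localA, Finset.univ_unique, Finset.sum_singleton, map_smul, conjMap_pureState,
        relabel_pureState]
      refine congrArg (fun ψ => (1 / 2 : ℂ) ^ k • pureState ψ) ?_
      ext ⟨⟨q', a⟩, ⟨q, b⟩⟩
      simp only [moveEquiv, Matrix.mulVec, dotProduct, Fintype.sum_prod_type, bellPrep, bellVec,
        Matrix.one_apply, Function.comp_apply, Matrix.kroneckerMap_apply,
        Equiv.coe_fn_symm_mk, Pi.smul_apply, Prod.ext_iff]
      by_cases h1 : q' = q <;> by_cases h2 : a = b <;> simp [h1, h2, eq_comm]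
    | bToA =>
      refine ⟨.gateB (fun _ : Fin 1 => bellPrep (Mem k)) (bellPrep_isometry _) (.wireBA c), ?_⟩
      rw [← hc]
      refine congrArg c.ideal ?_
      rw [bellState_succ, bellState]
      simp only [localB, Finset.univ_unique, Finset.sum_singleton, map_smul, conjMap_pureState,
        relabel_pureState]
      refine congrArg (fun ψ => (1 / 2 : ℂ) ^ k • pureState ψ) ?_
      ext ⟨⟨q', a⟩, ⟨q, b⟩⟩
      simp only [moveEquiv, Matrix.mulVec, dotProduct, Fintype.sum_prod_type, bellPrep, bellVec,
        Matrix.one_apply, Function.comp_apply, Matrix.kroneckerMap_apply, Equiv.coe_fn_mk,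
        Pi.smul_apply, Prod.ext_iff]
      by_cases h1 : q' = q <;> by_cases h2 : a = b <;> simp [h1, h2]

theorem le_of_mem_cutNorms {w : List Dir} {x : ℝ} (hx : x ∈ cutNorms w) :
    2 * (2 : ℝ) ^ w.length - 1 ≤ x := by
  obtain ⟨m, -, a, σ, h, rfl⟩ := hx
  obtain ⟨c, hc⟩ := exists_circuit_ideal_bellState w.length w 0 (by simp)
  have hd : (1 : ℝ) ≤ 2 ^ w.length := one_le_pow₀ (by norm_num)
  have h1 : bellWitness (Mem w.length) (c.ideal (bellState 0)) =
      ((2 * 2 ^ w.length - 1 : ℝ) : ℂ) := by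
    rw [hc, bellState, map_smul, bellWitness_bellVec, Mem.card, smul_eq_mul, ← mul_assoc]
    push_cast
    rw [← mul_pow]
    norm_num
  rw [h _ _ _ _ c, LinearMap.sum_apply, map_sum] at h1
  have h2 := congrArg norm h1
  rw [Complex.norm_real, Real.norm_of_nonneg (by linarith)] at h2
  rw [← h2]
  refine (norm_sum_le _ _).trans (Finset.sum_le_sum fun i _ => ?_)
  rw [LinearMap.smul_apply, map_smul, norm_smul, Complex.norm_real, Real.norm_eq_abs]
  refine mul_le_of_le_one_right (abs_nonneg _) ?_
  -- Memories and circuit systems are all one-dimensional at the start, so the input is a product of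
  -- unit vectors and each replacement contributes at most 1.
  have hb := Circuit.boundedOnProducts_run (bellWitness (Mem w.length)) norm_bellWitness_le c (σ i)
    (fun _ => 1) (fun _ => 1)
  have h1 : sqNorm (fun _ : Unit × Unit => (1 : ℂ)) = 1 := by
    simp [sqNorm_eq_sum]
  have h1' : sqNorm (fun _ : Unit × Mem 0 => (1 : ℂ)) = 1 := h1
  rw [h1', mul_one] at hb
  refine le_of_eq_of_le (congrArg norm ?_) hb
  refine congrArg (fun X => bellWitness (Mem w.length) (c.run (σ i) X)) ?_
  ext p q
  have h0 : ∀ p q : Mem 0 × Mem 0, bellState 0 p q = 1 := by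
    intro p q
    simp [bellState, pureState_apply, bellVec]
  refine (h0 _ _).trans ?_
  simp [pureState_apply, jointVec]

/-! ### Measure-and-prepare decomposition of the identity channel -/

/-- A measure-and-prepare channel: a measurement with rank-one effects, whose conjugate vectors
are `meas t`, and the state `prep t` that is prepared after the outcome `t`. -/
structure MeasurePrepare (ι : Type) [Fintype ι] [DecidableEq ι] where
  /-- The outcomes of the measurement. -/
  T : Type
  [fintype : Fintype T]
  /-- The conjugates of the vectors of the measurement. -/
  meas : T → ι → ℂ
  /-- The prepared vectors. -/
  prep : T → ι → ℂ
  meas_sum : ∀ i j, ∑ t, meas t i * star (meas t j) = if i = j then 1 else 0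
  prep_norm : ∀ t, ∑ i, prep t i * star (prep t i) = 1

attribute [instance] MeasurePrepare.fintype

/-- The Choi operator of a measure-and-prepare channel. -/
def MeasurePrepare.choi {ι : Type} [Fintype ι] [DecidableEq ι] (P : MeasurePrepare ι) :
    Op (ι × ι) :=
  ∑ t, pureState (prodVec (P.meas t) (P.prep t))

theorem MeasurePrepare.choi_apply {ι : Type} [Fintype ι] [DecidableEq ι] (P : MeasurePrepare ι)
    (j k l m : ι) : P.choi (j, k) (l, m) =
      ∑ t, P.meas t j * P.prep t k * star (P.meas t l * P.prep t m) := by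
  simp only [choi, Matrix.sum_apply]
  rfl

/-! ### The two measure-and-prepare channels of the decomposition -/

/-- A vector of phases that are cube roots of unity. -/
noncomputable def phaseVec {ι : Type} (θ : ι → ZMod 3) (i : ι) : ℂ := ZMod.stdAddChar (θ i)

theorem star_phaseVec {ι : Type} (θ : ι → ZMod 3) (i : ι) :
    star (phaseVec θ i) = ZMod.stdAddChar (-θ i) := (AddChar.map_neg_eq_conj _ _).symm

theorem phaseVec_mul_star {ι : Type} (θ : ι → ZMod 3) (i : ι) :
    phaseVec θ i * star (phaseVec θ i) = 1 := by
  rw [star_phaseVec, phaseVec, ← AddChar.map_add_eq_mul, add_neg_cancel, AddChar.map_zero_eq_one]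

/-- Character orthogonality: the sum vanishes unless `-θ j + θ k + θ l - θ m` is zero for all `θ`.
Cube roots are used because signs `±1` would also allow `j = m`, `k = l`; modulo 3 the form `2(θ k -
θ j)` is nonzero for `j ≠ k`. -/
theorem sum_phaseVec {ι : Type} [Fintype ι] [DecidableEq ι] (j k l m : ι) :
    ∑ θ : ι → ZMod 3, star (phaseVec θ j) * phaseVec θ k *
        (phaseVec θ l * star (phaseVec θ m)) =
      if (j = k ∧ l = m) ∨ (j = l ∧ k = m) then 3 ^ Fintype.card ι else 0 := by
  let L : (ι → ZMod 3) →+ ZMod 3 :=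
    { toFun := fun θ => -θ j + θ k + (θ l + -θ m)
      map_zero' := by simp
      map_add' := fun x y => by simp only [Pi.add_apply]; ring }
  have h1 : ∀ θ : ι → ZMod 3, star (phaseVec θ j) * phaseVec θ k *
      (phaseVec θ l * star (phaseVec θ m)) =
      ((ZMod.stdAddChar (N := 3)).compAddMonoidHom L) θ := by
    intro θ
    simp only [star_phaseVec]
    simp only [phaseVec, ← AddChar.map_add_eq_mul]
    rfl
  simp only [h1]
  have h2 : (ZMod.stdAddChar (N := 3)).compAddMonoidHom L = 0 ↔
      (j = k ∧ l = m) ∨ (j = l ∧ k = m) := by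
    constructor
    · intro h
      -- Testing on unit vectors at the four indices determines which of them coincide.
      have hL : ∀ t, -(Pi.single t 1 : ι → ZMod 3) j + (Pi.single t 1 : ι → ZMod 3) k +
          ((Pi.single t 1 : ι → ZMod 3) l + -(Pi.single t 1 : ι → ZMod 3) m) = 0 := by
        intro t
        refine ZMod.injective_stdAddChar ((DFunLike.congr_fun h (Pi.single t 1)).trans ?_)
        rw [AddChar.map_zero_eq_one]
        rfl
      have hj := hL j
      have hk := hL k
      have hl := hL l
      have hm := hL m
      simp only [Pi.single_apply] at hj hk hl hm
      grind
    · intro h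
      ext θ
      have : L θ = 0 := by
        change -θ j + θ k + (θ l + -θ m) = 0
        rcases h with ⟨rfl, rfl⟩ | ⟨rfl, rfl⟩ <;> ring
      simp [this]
  classical
  rw [AddChar.sum_eq_ite]
  simp only [h2, Fintype.card_pi, ZMod.card, Finset.prod_const, Finset.card_univ]
  push_cast
  rfl

theorem ofReal_sqrt_inv_mul_star {x : ℝ} (hx : 0 ≤ x) :
    (((Real.sqrt x)⁻¹ : ℝ) : ℂ) * star (((Real.sqrt x)⁻¹ : ℝ) : ℂ) = ((x⁻¹ : ℝ) : ℂ) := by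
  rw [RCLike.star_def, Complex.conj_ofReal, ← Complex.ofReal_mul, ← mul_inv, Real.mul_self_sqrt hx]

theorem mul_star_mul (a b c d : ℂ) : a * b * star (c * d) = a * star c * (b * star d) := by
  rw [star_mul']
  ring

/-- The measurement in a random phase basis, after which the outcome is prepared again. -/
noncomputable def phaseMeasurePrepare (ι : Type) [Fintype ι] [DecidableEq ι] [Nonempty ι] :
    MeasurePrepare ι where
  T := ι → ZMod 3
  meas θ i := (((Real.sqrt (3 ^ Fintype.card ι))⁻¹ : ℝ) : ℂ) * star (phaseVec θ i)
  prep θ i := (((Real.sqrt (Fintype.card ι))⁻¹ : ℝ) : ℂ) * phaseVec θ i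
  meas_sum i j := by
    have h := sum_phaseVec i j i i
    simp only [phaseVec_mul_star, mul_one, and_true] at h
    have h3 : (0 : ℝ) ≤ 3 ^ Fintype.card ι := by positivity
    simp only [mul_star_mul, ofReal_sqrt_inv_mul_star h3,
      star_star, ← Finset.mul_sum, h]
    by_cases e : i = j <;> simp [e, eq_comm]
  prep_norm θ := by
    simp only [mul_star_mul, ofReal_sqrt_inv_mul_star (Nat.cast_nonneg _), phaseVec_mul_star]
    simp

/-- Up to the factor `1 / d` this is `|Ω⟩⟨Ω|` plus the projector `D` onto the basis vectors `|jk⟩`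
with `j ≠ k`. -/
theorem phaseMeasurePrepare_choi {ι : Type} [Fintype ι] [DecidableEq ι] [Nonempty ι]
    (j k l m : ι) : (phaseMeasurePrepare ι).choi (j, k) (l, m) =
      (Fintype.card ι : ℂ)⁻¹ * if (j = k ∧ l = m) ∨ (j = l ∧ k = m) then 1 else 0 := by
  have h3 : (0 : ℝ) ≤ 3 ^ Fintype.card ι := by positivity
  have h : ∀ t : ι → ZMod 3, (phaseMeasurePrepare ι).meas t j * (phaseMeasurePrepare ι).prep t k *
      star ((phaseMeasurePrepare ι).meas t l * (phaseMeasurePrepare ι).prep t m) =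
      (((3 ^ Fintype.card ι : ℝ)⁻¹ : ℝ) : ℂ) * (((Fintype.card ι : ℝ)⁻¹ : ℝ) : ℂ) *
        (star (phaseVec t j) * phaseVec t k * (phaseVec t l * star (phaseVec t m))) := by
    intro t
    rw [← ofReal_sqrt_inv_mul_star h3, ← ofReal_sqrt_inv_mul_star (Nat.cast_nonneg _)]
    simp only [phaseMeasurePrepare, star_mul', star_star]
    ring
  rw [MeasurePrepare.choi_apply]
  refine (Finset.sum_congr rfl fun t _ => h t).trans ?_
  change ∑ t : ι → ZMod 3, _ = _
  rw [← Finset.mul_sum]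
  refine (congrArg _ (sum_phaseVec j k l m)).trans ?_
  push_cast
  split_ifs
  · field_simp
  · simp

/-- The measurement in the computational basis, after which a random different basis state is
prepared. -/
noncomputable def shiftMeasurePrepare (ι : Type) [Fintype ι] [DecidableEq ι] [Nontrivial ι] :
    MeasurePrepare ι where
  T := ι × ι
  -- The outcome `(a, b)` means that `a` is measured and `b` prepared; pairs with `a = b` get the
  -- zero effect, which leaves `d - 1` choices of `b` for each `a`.
  meas t i := if t.1 = t.2 then 0 else
    if t.1 = i then (((Real.sqrt ((Fintype.card ι : ℝ) - 1))⁻¹ : ℝ) : ℂ) else 0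
  prep t i := if t.2 = i then 1 else 0
  meas_sum i j := by
    have hd : (1 : ℝ) < Fintype.card ι := by exact_mod_cast Fintype.one_lt_card
    have hd' : (Fintype.card ι : ℂ) - 1 ≠ 0 := by
      have := sub_ne_zero.mpr hd.ne'
      exact_mod_cast this
    have h : ∀ t : ι × ι, (if t.1 = t.2 then 0 else
        if t.1 = i then (((Real.sqrt ((Fintype.card ι : ℝ) - 1))⁻¹ : ℝ) : ℂ) else 0) *
        star (if t.1 = t.2 then 0 else
        if t.1 = j then (((Real.sqrt ((Fintype.card ι : ℝ) - 1))⁻¹ : ℝ) : ℂ) else 0) =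
        if t.1 = i then (if i = j then
          ((Fintype.card ι : ℂ) - 1)⁻¹ * (1 - if t.2 = i then 1 else 0) else 0) else 0 := by
      rintro ⟨a, b⟩
      have h0 := ofReal_sqrt_inv_mul_star (x := (Fintype.card ι : ℝ) - 1) (by linarith)
      push_cast at h0
      by_cases h1 : a = i <;> by_cases h2 : i = j <;> by_cases h3 : b = i <;>
        simp_all [- RCLike.star_def, eq_comm]
    simp only [h, Fintype.sum_prod_type_right, Finset.sum_ite_eq', Finset.mem_univ, if_true]
    by_cases e : i = j
    · simp [e, ← Finset.mul_sum, hd']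
    · simp [e]
  prep_norm t := by simp

/-- This is `D / (d - 1)`, which cancels the surplus of the phase channel. -/
theorem shiftMeasurePrepare_choi {ι : Type} [Fintype ι] [DecidableEq ι] [Nontrivial ι]
    (j k l m : ι) : (shiftMeasurePrepare ι).choi (j, k) (l, m) =
      ((Fintype.card ι : ℂ) - 1)⁻¹ * if j = l ∧ k = m ∧ j ≠ k then 1 else 0 := by
  have hd : (1 : ℝ) < Fintype.card ι := by exact_mod_cast Fintype.one_lt_card
  have h0 := ofReal_sqrt_inv_mul_star (x := (Fintype.card ι : ℝ) - 1) (by linarith)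
  push_cast at h0
  rw [MeasurePrepare.choi_apply]
  refine (Fintype.sum_eq_single ((j, k) : ι × ι) ?_).trans ?_
  · rintro ⟨a, b⟩ hab
    by_cases h1 : a = j
    · have h2 : b ≠ k := fun h2 => hab (by rw [h1, h2])
      simp [shiftMeasurePrepare, h2]
    · simp [shiftMeasurePrepare, h1]
  · by_cases h1 : j = k <;> by_cases h2 : j = l <;> by_cases h3 : k = m <;>
      simp_all [- RCLike.star_def, shiftMeasurePrepare]

theorem exists_bellVec_decomposition (ι : Type) [Fintype ι] [DecidableEq ι] [Nonempty ι] :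
    ∃ P Q : MeasurePrepare ι, pureState (bellVec ι) =
      (Fintype.card ι : ℂ) • P.choi - ((Fintype.card ι : ℂ) - 1) • Q.choi := by
  have h0 : (Fintype.card ι : ℂ) ≠ 0 := by simp
  rcases subsingleton_or_nontrivial ι with h | h
  -- For `d = 1` the second coefficient vanishes, so any channel may take the second place.
  · refine ⟨phaseMeasurePrepare ι, phaseMeasurePrepare ι, ?_⟩
    ext ⟨j, k⟩ ⟨l, m⟩
    have hc : Fintype.card ι = 1 := le_antisymm (Fintype.card_le_one_iff_subsingleton.mpr h)
      Fintype.card_pos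
    simp [phaseMeasurePrepare_choi, hc, pureState_apply, bellVec, eq_iff_true_of_subsingleton]
  · refine ⟨phaseMeasurePrepare ι, shiftMeasurePrepare ι, ?_⟩
    ext ⟨j, k⟩ ⟨l, m⟩
    have hd : (Fintype.card ι : ℂ) - 1 ≠ 0 := by
      have h1 : (Fintype.card ι : ℂ) ≠ 1 := by exact_mod_cast Fintype.one_lt_card.ne'
      exact sub_ne_zero.mpr h1
    simp only [Matrix.sub_apply, Matrix.smul_apply, phaseMeasurePrepare_choi,
      shiftMeasurePrepare_choi, smul_eq_mul, mul_inv_cancel_left₀ h0, mul_inv_cancel_left₀ hd,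
      pureState_apply, bellVec]
    by_cases h1 : j = k <;> by_cases h2 : j = l <;> by_cases h3 : k = m <;>
      simp_all

/-! ### Upper bound for parallel cuts -/

theorem MeasurePrepare.exists_mem_Gam_LOCC {ι : Type} [Fintype ι] [DecidableEq ι] (z : ι)
    (P : MeasurePrepare ι) : ∃ F ∈ Gam z '' LOCC ι ι, ∀ X b b',
      F X b b' = ∑ a, ∑ a', X a a' * P.choi (a, b) (a', b') := by
  -- Alice measures and resets her system to `|z⟩`; Bob's `L t` sends `|z⟩` to the prepared vector.
  -- `L t` is not an isometry in general, but nothing is lost since `B` starts in `|z⟩`.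
  obtain ⟨K, hKa⟩ : ∃ K : P.T → Matrix ι ι ℂ, ∀ t i a, K t i a =
    if i = z then P.meas t a else 0 := ⟨_, fun _ _ _ => rfl⟩
  obtain ⟨L, hLa⟩ : ∃ L : P.T → Matrix ι ι ℂ, ∀ t i b, L t i b =
    if b = z then P.prep t i else 0 := ⟨_, fun _ _ _ => rfl⟩
  have hK : ∑ t, (K t).conjTranspose * K t = 1 := by
    ext a b
    have h := P.meas_sum b a
    simp only [Matrix.sum_apply, Matrix.mul_apply, Matrix.conjTranspose_apply, hKa, apply_ite star,
      star_zero, ite_mul, zero_mul, mul_ite, mul_zero, Finset.sum_ite_eq', Finset.mem_univ, if_true,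
      Matrix.one_apply]
    simp only [eq_comm (a := a), ← h, mul_comm]
  have hL : ∀ t, (1 - (L t).conjTranspose * L t).PosSemidef := by
    intro t
    have : 1 - (L t).conjTranspose * L t =
        Matrix.diagonal fun i => if i = z then (0 : ℂ) else 1 := by
      ext a b
      have h : ∑ i, star (P.prep t i) * P.prep t i = 1 := by
        simp only [← P.prep_norm t, mul_comm]
      by_cases h1 : a = b <;> by_cases h2 : b = z <;> by_cases h3 : a = z <;>
        simp_all [Matrix.mul_apply, - RCLike.star_def]
    rw [this]
    exact Matrix.PosSemidef.diagonal fun i => by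
      by_cases h : i = z <;> simp [h]
  refine ⟨_, ⟨_, IsLOCC.alice_sum (B := ι) K hK _
    fun t => IsLOCC.bob_single (L t) (hL t) .done, rfl⟩, fun X b b' => ?_⟩
  have h1 : ∀ t, conjMap ((1 : Matrix ι ι ℂ) ⊗ₖ L t) (conjMap (K t ⊗ₖ (1 : Matrix ι ι ℂ))
      (adjoinBasisState ι z X)) =
      (K t * X * (K t).conjTranspose) ⊗ₖ (L t * Matrix.single z z 1 * (L t).conjTranspose) := by
    intro t
    simp only [conjMap_apply, adjoinBasisState, LinearMap.coe_mk, AddHom.coe_mk,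
      Matrix.conjTranspose_kronecker, ← Matrix.mul_kronecker_mul, Matrix.conjTranspose_one,
      Matrix.one_mul, Matrix.mul_one]
  have h2 : ∀ t a, (K t * X * (K t).conjTranspose) a a =
      if a = z then ∑ i, ∑ j, P.meas t i * X i j * star (P.meas t j) else 0 := by
    intro t a
    by_cases h : a = z
    · simp only [Matrix.mul_apply, Matrix.conjTranspose_apply, hKa, h, if_true, Finset.sum_mul]
      exact Finset.sum_comm
    · simp [Matrix.mul_apply, hKa, h]
  have h3 : ∀ t, (L t * Matrix.single z z (1 : ℂ) * (L t).conjTranspose) b b' =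
      P.prep t b * star (P.prep t b') := by
    intro t
    simp [Matrix.mul_apply, hLa, Matrix.single_apply, Finset.sum_ite_eq, ite_and,
      apply_ite]
  simp only [Gam, LinearMap.comp_apply, LinearMap.sum_apply, LinearMap.id_apply, map_sum, h1,
    Matrix.sum_apply, MeasurePrepare.choi_apply, Finset.mul_sum]
  change ∑ t, ∑ a, (K t * X * (K t).conjTranspose) a a *
    (L t * Matrix.single z z (1 : ℂ) * (L t).conjTranspose) b b' = _
  simp only [h2, h3, ite_mul, zero_mul, Finset.sum_ite_eq', Finset.mem_univ, if_true,
    Finset.sum_mul]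
  rw [Finset.sum_comm]
  refine Finset.sum_congr rfl fun i _ => ?_
  rw [Finset.sum_comm]
  refine Finset.sum_congr rfl fun j _ => Finset.sum_congr rfl fun t _ => ?_
  rw [mul_star_mul]
  ring

theorem mem_qpdNorms {ι : Type} [Fintype ι] [DecidableEq ι] (z : ι) :
    2 * (Fintype.card ι : ℝ) - 1 ∈ qpdNorms (Gam z '' LOCC ι ι) LinearMap.id := by
  have : Nonempty ι := ⟨z⟩
  have hd : (1 : ℝ) ≤ Fintype.card ι := by exact_mod_cast Fintype.card_pos_iff.mpr ⟨z⟩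
  obtain ⟨P, Q, h⟩ := exists_bellVec_decomposition ι
  obtain ⟨F, hF, hFX⟩ := P.exists_mem_Gam_LOCC z
  obtain ⟨G, hG, hGX⟩ := Q.exists_mem_Gam_LOCC z
  refine ⟨2, by norm_num, ![Fintype.card ι, 1 - Fintype.card ι], ![F, G], ?_, ?_, ?_⟩
  · exact Fin.forall_fin_two.mpr ⟨hF, hG⟩
  · ext1 X
    ext b b'
    have h1 : ∀ a a', (if a = b then if a' = b' then X a a' else 0 else 0) =
        X a a' * pureState (bellVec ι) (a, b) (a', b') := by
      intro a a'
      by_cases h1 : a = b <;> by_cases h2 : a' = b' <;> simp [pureState_apply, bellVec, h1, h2]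
    -- The Choi operator of the identity channel is `|Ω⟩⟨Ω|`.
    have h2 : X b b' = ∑ a, ∑ a', X a a' * pureState (bellVec ι) (a, b) (a', b') := by
      simp only [← h1]
      simp
    rw [LinearMap.id_apply, h2, h]
    simp only [Fin.sum_univ_two, LinearMap.add_apply, LinearMap.smul_apply, Matrix.add_apply,
      Matrix.smul_apply, Matrix.cons_val_zero, Matrix.cons_val_one, hFX, hGX, smul_eq_mul,
      Finset.mul_sum, ← Finset.sum_add_distrib, Matrix.sub_apply]
    push_cast
    exact Finset.sum_congr rfl fun a _ => Finset.sum_congr rfl fun a' _ => by ring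
  · simp only [Fin.sum_univ_two, Matrix.cons_val_zero, Matrix.cons_val_one]
    rw [abs_of_nonneg (by linarith), abs_of_nonpos (by linarith)]
    ring

/-! ### Kraus operators with at most one entry in each row -/

/-- The matrix with the entry `χ i` at the position `(i, f i)` and zeros elsewhere. -/
def rowMatrix {I J : Type} [DecidableEq J] (f : I → J) (χ : I → ℂ) : Matrix I J ℂ :=
  Matrix.of fun i j => if f i = j then χ i else 0

theorem rowMatrix_apply {I J : Type} [DecidableEq J] (f : I → J) (χ : I → ℂ) (i : I) (j : J) :
    rowMatrix f χ i j = if f i = j then χ i else 0 := rfl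

theorem conjMap_rowMatrix_apply {I J : Type} [Fintype J] [DecidableEq J] (f : I → J)
    (χ : I → ℂ) (x : Op J) (i i' : I) :
    conjMap (rowMatrix f χ) x i i' = χ i * star (χ i') * x (f i) (f i') := by
  simp only [conjMap_apply, Matrix.mul_apply, Matrix.conjTranspose_apply, rowMatrix_apply, ite_mul,
    zero_mul, Finset.sum_ite_eq, Finset.mem_univ, if_true, apply_ite star, star_zero, mul_ite,
    mul_zero]
  ring

theorem rowMatrix_kronecker_one {I J B : Type} [DecidableEq J] [DecidableEq B] (f : I → J)
    (χ : I → ℂ) : rowMatrix f χ ⊗ₖ (1 : Matrix B B ℂ) =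
      rowMatrix (fun p : I × B => (f p.1, p.2)) fun p => χ p.1 := by
  ext ⟨i, b⟩ ⟨j, b'⟩
  by_cases h1 : f i = j <;> by_cases h2 : b = b' <;>
    simp [rowMatrix_apply, h1, h2]

theorem one_kronecker_rowMatrix {I J A : Type} [DecidableEq J] [DecidableEq A] (f : I → J)
    (χ : I → ℂ) : (1 : Matrix A A ℂ) ⊗ₖ rowMatrix f χ =
      rowMatrix (fun p : A × I => (p.1, f p.2)) fun p => χ p.2 := by
  ext ⟨a, i⟩ ⟨a', j⟩
  by_cases h1 : f i = j <;> by_cases h2 : a = a' <;>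
    simp [rowMatrix_apply, h1, h2]

theorem rowMatrix_isometry {I J : Type} [Fintype I] [Fintype J] [DecidableEq J] (e : I ≃ J)
    (χ : I → ℂ) (hχ : ∀ i, χ i * star (χ i) = 1) :
    (rowMatrix e χ).conjTranspose * rowMatrix e χ = 1 := by
  ext j j'
  rw [Matrix.mul_apply, ← e.symm.sum_comp]
  simp only [Matrix.conjTranspose_apply, rowMatrix_apply, Equiv.apply_symm_apply,
    apply_ite star, star_zero, ite_mul, zero_mul, Finset.sum_ite_eq',
    Finset.mem_univ, if_true, Matrix.one_apply, mul_ite, mul_zero]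
  rw [mul_comm, hχ]
  simp only [eq_comm]

theorem conjMap_smul {ι κ : Type} [Fintype ι] (c : ℂ) (K : Matrix κ ι ℂ) :
    conjMap (c • K) = (c * star c) • conjMap K := by
  ext1 X
  simp only [conjMap_apply, LinearMap.smul_apply, Matrix.conjTranspose_smul, Matrix.smul_mul,
    Matrix.mul_smul, smul_smul]
  rw [mul_comm]

/-! ### Preparation of separable states of the memories -/

/-- The Kraus operator that adjoins a memory in the state `α`. -/
def attach {S M T : Type} [DecidableEq S] (e : T ≃ S × M) (α : M → ℂ) : Matrix T S ℂ :=
  rowMatrix (fun t => (e t).1) fun t => α (e t).2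

theorem attach_conjTranspose_mul {S M T : Type} [Fintype S] [DecidableEq S] [Fintype M]
    [Fintype T] (e : T ≃ S × M) (α : M → ℂ) :
    (attach e α).conjTranspose * attach e α = (∑ m, α m * star (α m)) • (1 : Matrix S S ℂ) := by
  ext s s'
  rw [Matrix.mul_apply, ← e.symm.sum_comp, Fintype.sum_prod_type_right]
  simp only [attach, Matrix.conjTranspose_apply, rowMatrix_apply, Equiv.apply_symm_apply,
    apply_ite star, star_zero, ite_mul, zero_mul, mul_ite, mul_zero, Finset.sum_ite_eq',
    Finset.mem_univ, if_true, Matrix.smul_apply, Matrix.one_apply, smul_eq_mul, mul_one]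
  by_cases h : s = s'
  · simp [h, mul_comm]
  · have h' : ¬ s' = s := fun e => h e.symm
    simp [h, h']

/-- The preparation of the memories in a separable state, proportional to the Choi operator of
`P`. -/
noncomputable def MeasurePrepare.prepare {M SA SB TA TB : Type} [Fintype M] [DecidableEq M]
    [Fintype SA] [DecidableEq SA] [Fintype SB] [DecidableEq SB] [Fintype TA] [DecidableEq TA]
    (P : MeasurePrepare M) (eA : TA ≃ SA × M) (eB : TB ≃ SB × M) :
    SuperOp (SA × SB) (TA × TB) :=
  ∑ t, conjMap ((1 : Matrix TA TA ℂ) ⊗ₖ attach eB (P.prep t)) ∘ₗ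
    conjMap (attach eA ((((Real.sqrt (Fintype.card M))⁻¹ : ℝ) : ℂ) • P.meas t) ⊗ₖ
      (1 : Matrix SB SB ℂ))

theorem MeasurePrepare.prepare_apply {M SA SB TA TB : Type} [Fintype M] [DecidableEq M]
    [Fintype SA] [DecidableEq SA] [Fintype SB] [DecidableEq SB] [Fintype TA] [DecidableEq TA]
    (P : MeasurePrepare M) (eA : TA ≃ SA × M) (eB : TB ≃ SB × M) (Y : Op (SA × SB))
    (p q : TA × TB) : P.prepare eA eB Y p q =
      ((Fintype.card M : ℂ)⁻¹ • P.choi) ((eA p.1).2, (eB p.2).2) ((eA q.1).2, (eB q.2).2) *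
        Y ((eA p.1).1, (eB p.2).1) ((eA q.1).1, (eB q.2).1) := by
  have h0 := ofReal_sqrt_inv_mul_star (x := Fintype.card M) (Nat.cast_nonneg _)
  push_cast at h0
  simp only [prepare, LinearMap.sum_apply, LinearMap.comp_apply, attach, one_kronecker_rowMatrix,
    rowMatrix_kronecker_one, Matrix.sum_apply, conjMap_rowMatrix_apply, Matrix.smul_apply,
    choi_apply, smul_eq_mul, Finset.mul_sum, Finset.sum_mul, ← h0, Pi.smul_apply, star_mul']
  refine Finset.sum_congr rfl fun t _ => ?_
  push_cast
  ring

/-- Completeness of the measurement gives `∑ t, ‖meas t‖² = d`. Hence Alice can draw `t` with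
probability `‖meas t‖² / d` while attaching that vector, and announce it; Bob attaches `prep t`. -/
theorem MeasurePrepare.isLOCC_comp_prepare {M SA SB TA TB A' B' : Type} [Fintype M]
    [DecidableEq M] [Nonempty M] [Fintype SA] [DecidableEq SA] [Fintype SB] [DecidableEq SB]
    [Fintype TA] [DecidableEq TA] [Fintype TB] (P : MeasurePrepare M) (eA : TA ≃ SA × M)
    (eB : TB ≃ SB × M) {E : SuperOp (TA × TB) (A' × B')} (hE : IsLOCC E) :
    IsLOCC (E ∘ₗ P.prepare eA eB) := by
  have h : E ∘ₗ P.prepare eA eB =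
      ∑ t, (E ∘ₗ conjMap ((1 : Matrix TA TA ℂ) ⊗ₖ attach eB (P.prep t))) ∘ₗ
        conjMap (attach eA ((((Real.sqrt (Fintype.card M))⁻¹ : ℝ) : ℂ) • P.meas t) ⊗ₖ
          (1 : Matrix SB SB ℂ)) := by
    ext1 Y
    simp only [prepare, LinearMap.comp_apply, LinearMap.sum_apply, map_sum]
  rw [h]
  refine IsLOCC.alice_sum _ ?_ _ fun t => IsLOCC.bob_single _ ?_ hE
  · simp only [attach_conjTranspose_mul, ← Finset.sum_smul, Pi.smul_apply, smul_eq_mul,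
      mul_star_mul, ofReal_sqrt_inv_mul_star (Nat.cast_nonneg _), ← Finset.mul_sum]
    rw [Finset.sum_comm]
    simp only [P.meas_sum, if_true]
    simp
  · rw [attach_conjTranspose_mul, P.prep_norm, one_smul, sub_self]
    exact .zero

/-- The joint replacement that prepares the memories before the first cut. -/
noncomputable def Replacement.withState : {w : List Dir} → {M : Type} → [Fintype M] →
    [DecidableEq M] → [Nonempty M] → MeasurePrepare M → Replacement w M M → Replacement w Unit Unit
  | _, _, _, _, _, _, .done => .done
  | _, M, _, _, _, P, @Replacement.wireAB _ _ _ _ _ _ _ E hE σ => .wireAB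
      (E ∘ₗ P.prepare (SA := Qubit × Unit) (SB := Unit)
        ((Equiv.prodPUnit Qubit).symm.prodCongr (Equiv.refl M)) (Equiv.punitProd M).symm)
      (P.isLOCC_comp_prepare _ _ hE) σ
  | _, M, _, _, _, P, @Replacement.wireBA _ _ _ _ _ _ _ E hE σ => .wireBA
      (E ∘ₗ P.prepare (SA := Unit) (SB := Qubit × Unit) (Equiv.punitProd M).symm
        ((Equiv.prodPUnit Qubit).symm.prodCongr (Equiv.refl M)))
      (P.isLOCC_comp_prepare _ _ hE) σ

theorem idTensor_kronecker {M ι κ : Type} (G : SuperOp ι κ) (ρ : Op M) (X : Op ι) :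
    idTensor M G (ρ ⊗ₖ X) = ρ ⊗ₖ G X := by
  ext ⟨m, k⟩ ⟨m', k'⟩
  exact congrFun (congrFun (G.map_smul (ρ m m') X) k) k'

/-- The preparation is merged into the operation at the first cut, hence `w ≠ []`. Gates before that
cut do not touch the memories and commute with the preparation. -/
theorem Circuit.run_withState {A' B' M : Type} [Fintype M] [DecidableEq M] [Nonempty M]
    (P : MeasurePrepare M) {w : List Dir} {A B : Type} (c : Circuit A' B' w A B) :
    w ≠ [] → ∀ (σ : Replacement w M M) (X : Op (A × B)),
      c.run (Replacement.withState P σ) (relabel (unitEquiv (A × B)).symm X) =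
        c.run σ (((Fintype.card M : ℂ)⁻¹ • P.choi) ⊗ₖ X) := by
  induction c with
  | done => exact fun h => absurd rfl h
  | @gateA w A B C _ _ _ _ _ m K hK c ih =>
    intro hw σ X
    refine (ih hw σ (localA (B := B) K X)).trans ?_
    rw [← idTensor_kronecker]
    rfl
  | @gateB w A B C _ _ _ _ _ m K hK c ih =>
    intro hw σ X
    refine (ih hw σ (localB (A := A) K X)).trans ?_
    rw [← idTensor_kronecker]
    rfl
  | @wireAB w A B c ih =>
    intro _ σ X
    cases σ with
    | @wireAB _ _ _ MA' MB' _ _ E hE σ =>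
      simp only [Replacement.withState, Circuit.run, tensorId_comp, LinearMap.comp_apply]
      refine congrArg (fun Y => c.run σ (relabel (shiftB _ _ _ _ _) (tensorId _ E Y))) ?_
      ext p q
      exact P.prepare_apply _ _ _ _ _
  | @wireBA w A B c ih =>
    intro _ σ X
    cases σ with
    | @wireBA _ _ _ MA' MB' _ _ E hE σ =>
      simp only [Replacement.withState, Circuit.run, tensorId_comp, LinearMap.comp_apply]
      refine congrArg (fun Y => c.run σ (relabel (shiftA _ _ _ _ _) (tensorId _ E Y))) ?_
      ext p q
      exact P.prepare_apply _ _ _ _ _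

/-! ### Teleportation -/

/-- The sign `(-1) ^ (z * q)`. -/
def phaseSign (z q : Qubit) : ℂ := if z = 1 ∧ q = 1 then -1 else 1

theorem star_phaseSign (z q : Qubit) : star (phaseSign z q) = phaseSign z q := by
  simp only [phaseSign, apply_ite star, star_neg, star_one]

theorem phaseSign_mul_self (z q : Qubit) : phaseSign z q * phaseSign z q = 1 := by
  unfold phaseSign
  split_ifs <;> norm_num

/-- The Kraus operators of the Bell measurement. -/
noncomputable def bellMeas (M : Type) [DecidableEq M] (o : Qubit × Qubit) :
    Matrix M (Qubit × (Qubit × M)) ℂ :=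
  Matrix.of fun m p => if p.2.1 = p.1 + o.1 ∧ m = p.2.2 then invSqrtTwo * phaseSign o.2 p.1 else 0

theorem sum_bellMeas (M : Type) [Fintype M] [DecidableEq M] :
    ∑ o, (bellMeas M o).conjTranspose * bellMeas M o = 1 := by
  have h : ∀ (o : Qubit × Qubit) (q a q' a' : Qubit) (m m' : M),
      ((bellMeas M o).conjTranspose * bellMeas M o) (q, (a, m)) (q', (a', m')) =
      if m = m' then (if a = q + o.1 ∧ a' = q' + o.1 then
        1 / 2 * (phaseSign o.2 q * phaseSign o.2 q') else 0) else 0 := by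
    intro o q a q' a' m m'
    by_cases h3 : m = m'
    · subst h3
      by_cases h1 : a = q + o.1 <;> by_cases h2 : a' = q' + o.1 <;>
        simp [Matrix.mul_apply, bellMeas, h1, h2, apply_ite, star_invSqrtTwo, star_phaseSign,
          - Complex.star_def]
      linear_combination (phaseSign o.2 q * phaseSign o.2 q') * invSqrtTwo_mul_self
    · have h3' : ∀ x, ¬ (x = m ∧ x = m') := fun x hx => h3 (hx.1.symm.trans hx.2)
      rw [Matrix.mul_apply, if_neg h3]
      refine Finset.sum_eq_zero fun x _ => ?_
      by_cases h1 : x = m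
      · have h2 : x ≠ m' := fun h2 => h3' x ⟨h1, h2⟩
        simp [bellMeas, h2]
      · simp [bellMeas, h1]
  ext ⟨q, a, m⟩ ⟨q', a', m'⟩
  rw [Matrix.sum_apply]
  simp only [h, Fintype.sum_prod_type, Fin.sum_univ_two, Matrix.one_apply, Prod.ext_iff]
  by_cases h3 : m = m'
  · fin_cases q <;> fin_cases a <;> fin_cases q' <;> fin_cases a' <;>
      simp [h3, phaseSign] <;> norm_num
  · simp [h3]

/-- The correction after a Bell measurement. -/
noncomputable def bellCorrection (M : Type) [DecidableEq M] (o : Qubit × Qubit) :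
    Matrix (Qubit × M) (Qubit × M) ℂ :=
  rowMatrix (fun p => (p.1 + o.1, p.2)) fun p => phaseSign o.2 p.1

theorem bellCorrection_isometry (M : Type) [Fintype M] [DecidableEq M] (o : Qubit × Qubit) :
    (bellCorrection M o).conjTranspose * bellCorrection M o = 1 :=
  rowMatrix_isometry ((Equiv.addRight o.1).prodCongr (Equiv.refl M)) _ fun p => by
    rw [star_phaseSign, phaseSign_mul_self]

/-- Teleportation of a qubit from the first computer to the second. -/
noncomputable def teleportAB (M : Type) [Fintype M] [DecidableEq M] :
    SuperOp ((Qubit × (Qubit × M)) × (Qubit × M)) (M × (Qubit × M)) :=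
  ∑ o, conjMap ((1 : Matrix M M ℂ) ⊗ₖ bellCorrection M o) ∘ₗ
    conjMap (bellMeas M o ⊗ₖ (1 : Matrix (Qubit × M) (Qubit × M) ℂ))

/-- Teleportation of a qubit from the second computer to the first. -/
noncomputable def teleportBA (M : Type) [Fintype M] [DecidableEq M] :
    SuperOp ((Qubit × M) × (Qubit × (Qubit × M))) ((Qubit × M) × M) :=
  ∑ o, conjMap (bellCorrection M o ⊗ₖ (1 : Matrix M M ℂ)) ∘ₗ
    conjMap ((1 : Matrix (Qubit × M) (Qubit × M) ℂ) ⊗ₖ bellMeas M o)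

theorem isLOCC_teleportAB (M : Type) [Fintype M] [DecidableEq M] : IsLOCC (teleportAB M) :=
  IsLOCC.alice_sum _ (sum_bellMeas M) _ fun o =>
    IsLOCC.bob_single (P := LinearMap.id) (bellCorrection M o)
      (by rw [bellCorrection_isometry, sub_self]; exact .zero) .done

theorem isLOCC_teleportBA (M : Type) [Fintype M] [DecidableEq M] : IsLOCC (teleportBA M) :=
  IsLOCC.bob_sum _ (sum_bellMeas M) _ fun o =>
    IsLOCC.alice_single (P := LinearMap.id) (bellCorrection M o)
      (by rw [bellCorrection_isometry, sub_self]; exact .zero) .done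

/-- The qubit to be teleported from the first computer next to the entangled memories. -/
noncomputable def teleportInAB (M : Type) [DecidableEq M] :
    Matrix ((Qubit × (Qubit × M)) × (Qubit × M)) Qubit ℂ :=
  rowMatrix (fun p => p.1.1) fun p => bellVec (Qubit × M) (p.1.2, p.2)

/-- The qubit teleported to the second computer next to the entangled memories. -/
noncomputable def teleportOutAB (M : Type) [DecidableEq M] :
    Matrix (M × (Qubit × M)) Qubit ℂ :=
  rowMatrix (fun p => p.2.1) fun p => bellVec M (p.1, p.2.2)

/-- The qubit to be teleported from the second computer next to the entangled memories. -/
noncomputable def teleportInBA (M : Type) [DecidableEq M] :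
    Matrix ((Qubit × M) × (Qubit × (Qubit × M))) Qubit ℂ :=
  rowMatrix (fun p => p.2.1) fun p => bellVec (Qubit × M) (p.1, p.2.2)

/-- The qubit teleported to the first computer next to the entangled memories. -/
noncomputable def teleportOutBA (M : Type) [DecidableEq M] :
    Matrix ((Qubit × M) × M) Qubit ℂ :=
  rowMatrix (fun p => p.1.1) fun p => bellVec M (p.1.2, p.2)

/-- The entangled vector ties Alice's memory to Bob's, so a single term of the matrix product
survives. -/
theorem bellMeas_teleportInAB (M : Type) [Fintype M] [DecidableEq M] (o : Qubit × Qubit)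
    (m m' : M) (b q : Qubit) :
    ((bellMeas M o ⊗ₖ (1 : Matrix (Qubit × M) (Qubit × M) ℂ)) * teleportInAB M) (m, (b, m')) q =
      bellMeas M o m (q, (b, m')) := by
  rw [Matrix.mul_apply, Fintype.sum_prod_type]
  refine (Fintype.sum_eq_single (q, (b, m')) ?_).trans ?_
  · rintro ⟨q1, a, m1⟩ h
    refine Finset.sum_eq_zero fun p _ => ?_
    by_cases h1 : q1 = q
    · have h2 : (a, m1) ≠ (b, m') := fun h2 => h (by rw [h1, h2])
      by_cases h3 : (b, m') = p
      · subst h3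
        simp [teleportInAB, rowMatrix_apply, bellVec, h2, - Prod.mk.injEq]
      · simp [h3, - Prod.mk.injEq]
    · simp [teleportInAB, rowMatrix_apply, h1]
  · simp only [Matrix.kroneckerMap_apply, Matrix.one_apply, mul_ite, mul_one, mul_zero, ite_mul,
      zero_mul, Finset.sum_ite_eq, Finset.mem_univ, if_true]
    simp [teleportInAB, rowMatrix_apply, bellVec]

theorem bellMeas_teleportInBA (M : Type) [Fintype M] [DecidableEq M] (o : Qubit × Qubit)
    (m m' : M) (b q : Qubit) :
    (((1 : Matrix (Qubit × M) (Qubit × M) ℂ) ⊗ₖ bellMeas M o) * teleportInBA M) ((b, m'), m) q =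
      bellMeas M o m (q, (b, m')) := by
  rw [Matrix.mul_apply, Fintype.sum_prod_type_right]
  refine (Fintype.sum_eq_single (q, (b, m')) ?_).trans ?_
  · rintro ⟨q1, a, m1⟩ h
    refine Finset.sum_eq_zero fun p _ => ?_
    by_cases h1 : q1 = q
    · have h2 : (b, m') ≠ (a, m1) := fun h2 => h (by rw [h1, h2])
      by_cases h3 : (b, m') = p
      · subst h3
        simp [teleportInBA, rowMatrix_apply, bellVec, h2, - Prod.mk.injEq]
      · simp [h3, - Prod.mk.injEq]
    · simp [teleportInBA, rowMatrix_apply, h1]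
  · simp only [Matrix.kroneckerMap_apply, Matrix.one_apply, ite_mul, one_mul,
      zero_mul, Finset.sum_ite_eq, Finset.mem_univ, if_true]
    simp [teleportInBA, rowMatrix_apply, bellVec]

theorem rowMatrix_mul_apply {I J L : Type} [Fintype J] [DecidableEq J] (f : I → J) (χ : I → ℂ)
    (N : Matrix J L ℂ) (i : I) (l : L) : (rowMatrix f χ * N) i l = χ i * N (f i) l := by
  simp [Matrix.mul_apply, rowMatrix_apply]

/-- After the correction all outcomes act by the same operator, since `phaseSign` squares to 1 and
the shift by `o.1` is undone. -/
theorem teleport_krausAB (M : Type) [Fintype M] [DecidableEq M] (o : Qubit × Qubit) :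
    ((1 : Matrix M M ℂ) ⊗ₖ bellCorrection M o) *
      ((bellMeas M o ⊗ₖ (1 : Matrix (Qubit × M) (Qubit × M) ℂ)) * teleportInAB M) =
      invSqrtTwo • teleportOutAB M := by
  ext ⟨m, q, m'⟩ q'
  rw [bellCorrection, one_kronecker_rowMatrix, rowMatrix_mul_apply, bellMeas_teleportInAB,
    Matrix.smul_apply]
  by_cases h1 : q = q' <;> by_cases h2 : m = m' <;>
    simp [teleportOutAB, bellMeas, rowMatrix_apply, bellVec, h1, h2]
  linear_combination invSqrtTwo * phaseSign_mul_self o.2 q'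

theorem teleport_krausBA (M : Type) [Fintype M] [DecidableEq M] (o : Qubit × Qubit) :
    (bellCorrection M o ⊗ₖ (1 : Matrix M M ℂ)) *
      (((1 : Matrix (Qubit × M) (Qubit × M) ℂ) ⊗ₖ bellMeas M o) * teleportInBA M) =
      invSqrtTwo • teleportOutBA M := by
  ext ⟨⟨q, m'⟩, m⟩ q'
  rw [bellCorrection, rowMatrix_kronecker_one, rowMatrix_mul_apply, bellMeas_teleportInBA,
    Matrix.smul_apply]
  by_cases h1 : q = q' <;> by_cases h2 : m = m' <;>
    simp [teleportOutBA, bellMeas, rowMatrix_apply, bellVec, h1, h2, eq_comm]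
  linear_combination -invSqrtTwo * phaseSign_mul_self o.2 q'

/-- Four outcomes of weight `1 / 2` give the factor 2, which later turns the normalisation `(1 / 2)
^ (k + 1)` into `(1 / 2) ^ k`. -/
theorem sum_conjMap_invSqrtTwo_smul {ι κ : Type} [Fintype ι] (K : Matrix κ ι ℂ) :
    ∑ _o : Qubit × Qubit, conjMap (invSqrtTwo • K) = (2 : ℂ) • conjMap K := by
  simp only [conjMap_smul, star_invSqrtTwo, invSqrtTwo_mul_self, Finset.sum_const,
    Finset.card_univ, Fintype.card_prod, Fintype.card_fin, ← Nat.cast_smul_eq_nsmul ℂ, smul_smul]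
  norm_num

theorem teleportAB_conjMap (M : Type) [Fintype M] [DecidableEq M] :
    teleportAB M ∘ₗ conjMap (teleportInAB M) = (2 : ℂ) • conjMap (teleportOutAB M) := by
  rw [← sum_conjMap_invSqrtTwo_smul]
  ext1 x
  simp only [teleportAB, LinearMap.comp_apply, LinearMap.sum_apply]
  refine Finset.sum_congr rfl fun o _ => ?_
  rw [← teleport_krausAB M o, ← conjMap_comp, ← conjMap_comp]
  rfl

theorem teleportBA_conjMap (M : Type) [Fintype M] [DecidableEq M] :
    teleportBA M ∘ₗ conjMap (teleportInBA M) = (2 : ℂ) • conjMap (teleportOutBA M) := by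
  rw [← sum_conjMap_invSqrtTwo_smul]
  ext1 x
  simp only [teleportBA, LinearMap.comp_apply, LinearMap.sum_apply]
  refine Finset.sum_congr rfl fun o _ => ?_
  rw [← teleport_krausBA M o, ← conjMap_comp, ← conjMap_comp]
  rfl

/-- The joint replacement that teleports the qubits of all wires. -/
noncomputable def teleportReplacement :
    (w : List Dir) → Replacement w (Mem w.length) (Mem w.length)
  | [] => .done
  | .aToB :: w => .wireAB (teleportAB (Mem w.length)) (isLOCC_teleportAB _) (teleportReplacement w)
  | .bToA :: w => .wireBA (teleportBA (Mem w.length)) (isLOCC_teleportBA _) (teleportReplacement w)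

/-- One replaced wire uses up one Bell pair and has the effect of passing the qubit. -/
theorem tensorId_teleportAB (k : ℕ) {A B : Type} (X : Op ((Qubit × A) × B)) :
    tensorId (A × B) (teleportAB (Mem k))
      (relabel (shiftA (Mem (k + 1)) (Mem (k + 1)) Qubit A B).symm
        (bellState (k + 1) ⊗ₖ X)) =
    relabel (shiftB (Mem k) (Mem k) Qubit A B).symm
      (bellState k ⊗ₖ relabel (moveEquiv Qubit A B).symm X) := by
  ext ⟨⟨m, q, m'⟩, a, b⟩ ⟨⟨n, r, n'⟩, c, d⟩
  have h := congrFun (congrFun (LinearMap.congr_fun (teleportAB_conjMap (Mem k))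
    (((1 / 2 : ℂ) ^ (k + 1)) • Matrix.of fun i j => X ((i, a), b) ((j, c), d)))
      (m, (q, m'))) (n, (r, n'))
  refine Eq.trans ?_ (h.trans ?_)
  -- For fixed indices of the remaining circuit systems, the input block is `conjMap (teleportInAB
  -- _)` of a one-qubit operator.
  · refine congrFun (congrFun (congrArg (teleportAB (Mem k)) ?_) _) _
    ext i j
    rw [teleportInAB, conjMap_rowMatrix_apply]
    change (1 / 2 : ℂ) ^ (k + 1) * (_ * star _) * _ = _ * star _ * ((1 / 2 : ℂ) ^ (k + 1) * _)
    rw [mul_comm ((1 / 2 : ℂ) ^ (k + 1)), mul_assoc]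
    rfl
  · rw [LinearMap.smul_apply, Matrix.smul_apply, teleportOutAB, conjMap_rowMatrix_apply]
    change (2 : ℂ) * (_ * star _ * ((1 / 2 : ℂ) ^ (k + 1) * X ((q, a), b) ((r, c), d))) =
      (1 / 2 : ℂ) ^ k * (bellVec (Mem k) (m, m') * star (bellVec (Mem k) (n, n'))) *
        X ((q, a), b) ((r, c), d)
    ring

theorem tensorId_teleportBA (k : ℕ) {A B : Type} (X : Op (A × (Qubit × B))) :
    tensorId (A × B) (teleportBA (Mem k))
      (relabel (shiftB (Mem (k + 1)) (Mem (k + 1)) Qubit A B).symm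
        (bellState (k + 1) ⊗ₖ X)) =
    relabel (shiftA (Mem k) (Mem k) Qubit A B).symm
      (bellState k ⊗ₖ relabel (moveEquiv Qubit A B) X) := by
  ext ⟨⟨⟨q, m'⟩, m⟩, a, b⟩ ⟨⟨⟨r, n'⟩, n⟩, c, d⟩
  have h := congrFun (congrFun (LinearMap.congr_fun (teleportBA_conjMap (Mem k))
    (((1 / 2 : ℂ) ^ (k + 1)) • Matrix.of fun i j => X (a, (i, b)) (c, (j, d))))
      ((q, m'), m)) ((r, n'), n)
  refine Eq.trans ?_ (h.trans ?_)
  · refine congrFun (congrFun (congrArg (teleportBA (Mem k)) ?_) _) _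
    ext i j
    rw [teleportInBA, conjMap_rowMatrix_apply]
    change (1 / 2 : ℂ) ^ (k + 1) * (_ * star _) * _ = _ * star _ * ((1 / 2 : ℂ) ^ (k + 1) * _)
    rw [mul_comm ((1 / 2 : ℂ) ^ (k + 1)), mul_assoc]
    rfl
  · rw [LinearMap.smul_apply, Matrix.smul_apply, teleportOutBA, conjMap_rowMatrix_apply]
    change (2 : ℂ) * (_ * star _ * ((1 / 2 : ℂ) ^ (k + 1) * X (a, (q, b)) (c, (r, d)))) =
      (1 / 2 : ℂ) ^ k * (bellVec (Mem k) (m', m) * star (bellVec (Mem k) (n', n))) *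
        X (a, (q, b)) (c, (r, d))
    ring

theorem Circuit.run_teleportReplacement {A' B' : Type} {w : List Dir} {A B : Type}
    (c : Circuit A' B' w A B) : ∀ X : Op (A × B),
      c.run (teleportReplacement w) (bellState w.length ⊗ₖ X) = c.ideal X := by
  induction c with
  | done =>
    intro X
    ext p q
    change bellState 0 _ _ * X p q = X p q
    simp [bellState, pureState_apply, bellVec]
  | @gateA w A B C _ _ _ _ _ m K hK c ih =>
    intro X
    refine Eq.trans ?_ (ih (localA (B := B) K X))
    rw [← idTensor_kronecker]
    rfl
  | @gateB w A B C _ _ _ _ _ m K hK c ih =>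
    intro X
    refine Eq.trans ?_ (ih (localB (A := A) K X))
    rw [← idTensor_kronecker]
    rfl
  | @wireAB w A B c ih =>
    intro X
    refine Eq.trans ?_ (ih (relabel (moveEquiv _ _ _).symm X))
    exact congrArg (fun Y => c.run (teleportReplacement w) (relabel (shiftB _ _ _ _ _) Y))
      (tensorId_teleportAB w.length X)
  | @wireBA w A B c ih =>
    intro X
    refine Eq.trans ?_ (ih (relabel (moveEquiv _ _ _) X))
    exact congrArg (fun Y => c.run (teleportReplacement w) (relabel (shiftA _ _ _ _ _) Y))
      (tensorId_teleportBA w.length X)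

instance Mem.nonempty (k : ℕ) : Nonempty (Mem k) :=
  Fintype.card_pos_iff.mp (by rw [Mem.card]; positivity)

theorem mem_cutNorms (w : List Dir) : 2 * (2 : ℝ) ^ w.length - 1 ∈ cutNorms w := by
  -- Without wires there is no cut at which to prepare the memories; the bound is then 1 and the
  -- single trivial replacement attains it.
  by_cases hw : w = []
  · subst hw
    refine ⟨1, le_rfl, fun _ => 1, fun _ => .done, fun A B A' B' _ _ _ _ c => ?_, by norm_num⟩
    ext1 X
    have h : relabel (unitEquiv (A × B)).symm X = bellState 0 ⊗ₖ X := by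
      ext p q
      change X p.2 q.2 = bellState 0 p.1 q.1 * X p.2 q.2
      simp [bellState, pureState_apply, bellVec]
    simp only [Finset.univ_unique, Finset.sum_singleton, Complex.ofReal_one, one_smul]
    rw [← c.run_teleportReplacement X, Circuit.simulate, LinearMap.comp_apply, h]
    rfl
  · obtain ⟨P, Q, h⟩ := exists_bellVec_decomposition (Mem w.length)
    have hd : (1 : ℝ) ≤ 2 ^ w.length := one_le_pow₀ (by norm_num)
    -- The Bell pairs as a signed combination of the two separable states; normalising all of them
    -- by `1 / d` leaves the coefficients `d` and `1 - d` unchanged.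
    have hb : bellState w.length = (2 ^ w.length : ℂ) •
        ((Fintype.card (Mem w.length) : ℂ)⁻¹ • P.choi) +
        (1 - 2 ^ w.length : ℂ) • ((Fintype.card (Mem w.length) : ℂ)⁻¹ • Q.choi) := by
      rw [bellState, h, Mem.card]
      push_cast
      rw [one_div, inv_pow]
      module
    refine ⟨2, by norm_num, ![2 ^ w.length, 1 - 2 ^ w.length],
      ![Replacement.withState P (teleportReplacement w),
        Replacement.withState Q (teleportReplacement w)],
      fun A B A' B' _ _ _ _ c => ?_, ?_⟩
    · ext1 X
      rw [← c.run_teleportReplacement X, hb, Matrix.add_kronecker,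
        Matrix.smul_kronecker (2 ^ w.length : ℂ) _ X,
        Matrix.smul_kronecker (1 - 2 ^ w.length : ℂ) _ X, map_add, map_smul, map_smul,
        ← c.run_withState P hw,
        ← c.run_withState Q hw]
      simp [Fin.sum_univ_two, Circuit.simulate]
    · simp only [Fin.sum_univ_two, Matrix.cons_val_zero, Matrix.cons_val_one]
      rw [abs_of_nonneg (by linarith), abs_of_nonpos (by linarith)]
      ring

theorem isLeast_samplingOverheads {N : Set ℝ} {x : ℝ} (hx : 0 ≤ x) (h : IsLeast N x) :
    IsLeast (samplingOverheads N) (x ^ 2) := by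
  refine ⟨⟨x, h.1, rfl⟩, ?_⟩
  rintro _ ⟨y, hy, rfl⟩
  exact pow_le_pow_left₀ hx (h.2 hy) 2

end WireCut

theorem mainTheorem2 (n : ℕ) :
    (IsLeast (WireCut.qpdNorms (WireCut.cutLOCC n) LinearMap.id) (2 ^ (n + 1) - 1) ∧
      IsLeast (WireCut.samplingOverheads
        (WireCut.qpdNorms (WireCut.cutLOCC n) LinearMap.id)) ((2 ^ (n + 1) - 1) ^ 2)) ∧
    (∀ w : List WireCut.Dir, w.length = n →
      IsLeast (WireCut.cutNorms w) (2 ^ (n + 1) - 1) ∧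
      IsLeast (WireCut.samplingOverheads (WireCut.cutNorms w)) ((2 ^ (n + 1) - 1) ^ 2)) := by
  have hn : (0 : ℝ) ≤ 2 ^ (n + 1) - 1 := sub_nonneg.mpr (one_le_pow₀ (by norm_num))
  have hc : 2 * (Fintype.card (WireCut.Qubits n) : ℝ) - 1 = 2 ^ (n + 1) - 1 := by
    simp [pow_succ']
  have h1 : IsLeast (WireCut.qpdNorms (WireCut.cutLOCC n) LinearMap.id) (2 ^ (n + 1) - 1) := by
    rw [← hc]
    exact ⟨WireCut.mem_qpdNorms 0, fun x hx => WireCut.le_of_mem_qpdNorms 0 hx⟩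
  refine ⟨⟨h1, WireCut.isLeast_samplingOverheads hn h1⟩, ?_⟩
  rintro w rfl
  have h2 : IsLeast (WireCut.cutNorms w) (2 ^ (w.length + 1) - 1) := by
    rw [pow_succ']
    exact ⟨WireCut.mem_cutNorms w, fun x hx => WireCut.le_of_mem_cutNorms hx⟩
  exact ⟨h2, WireCut.isLeast_samplingOverheads hn h2⟩
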